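/- \begin{theorem} Let $K$ be a field and let $A$ be a finite dimensional, basic and elementary Nakayama $K$-algebra whose quiver is the oriented cycle $0\to 1\to\cdots\to n-1\to 0$ ($n\ge 1$). Let $(e_i)_{i\in\mathbb{Z}/n}$ be the corresponding primitive orthogonal idempotents, so that $\dim_K e_i(J/J^2)e_j=1$ if $j=i+1$ and $=0$ otherwise, where $J$ is the Jacobson radical of $A$. Modules are finite dimensional right modules, $D=\mathrm{Hom}_K(-,K)$, and $S_i$ denotes the simple top of $e_iA$. Assume that $A$ is not selfinjective. Terminology. The \emph{dominant dimension} of a module $M$ with minimal injective resolution $0\to M\to I_0\to I_1\to\cdots$ is the supremum of all $m\ge 0$ such that $I_0,\dots,I_{m-1}$ are projective, and $\mathrm{Dom}_2$ is the class of modules of dominant dimension at least $2$. The \emph{resolution quiver} of $A$ has the vertices $i\in\mathbb{Z}/n$ and an arrow $i\to j$ iff $S_j\cong\tau(\mathrm{soc}\,P(S_i))$, where $P(S_i)$ is the projective cover of $S_i$ and $\tau=D\,\mathrm{Tr}$. A vertex $i$ is \emph{black} if $S_i$ has projective dimension at least $2$, and \emph{cyclically black} if it lies on a cycle of the resolution quiver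 all of whose vertices are black. A module $M$ is \emph{Gorenstein projective} if $\mathrm{Ext}^l(M,A)=0=\mathrm{Ext}^l(\mathrm{Tr}\,M,A)$ for all $l\ge 1$. The \emph{Gorenstein core} of $A$ consists of all finite direct sums of indecomposable nonprojective Gorenstein projective modules and of projective covers of such modules. $A$ is \emph{Gorenstein dominant} if $A$ has dominant dimension at least $1$ as a right module and every Gorenstein projective module without nonzero projective direct summands has dominant dimension at least $2$. Then: \begin{enumerate} \item If a vertex $i$ is cyclically black, then the right module $D(Ae_{i-1})$ is projective. \item The Gorenstein core of $A$ is contained in $\mathrm{Dom}_2$, and $A$ is Gorenstein dominant. \end{enumerate} \end{theorem} -/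

import Mathlib

universe u

/-! ### Modules over an arbitrary ring -/

namespace Nak

/-- A module is uniserial if its submodules form a chain. -/
def IsUniserial (R : Type u) [Ring R] (M : Type u) [AddCommGroup M] [Module R M] : Prop :=
  ∀ N N' : Submodule R M, N ≤ N' ∨ N' ≤ N

/-- An indecomposable module: nonzero, and with no nontrivial direct sum decomposition. -/
def IsIndecomposable (R : Type u) [Ring R] (M : Type u) [AddCommGroup M] [Module R M] : Prop :=
  Nontrivial M ∧ ∀ N N' : Submodule R M, IsCompl N N' → N = ⊥ ∨ N' = ⊥

/-- `f : P → M` is a projective cover: `P` is projective, `f` is onto and its kernel is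
superfluous. -/
structure IsProjectiveCover {R : Type u} [Ring R] {P M : Type u} [AddCommGroup P] [Module R P]
    [AddCommGroup M] [Module R M] (f : P →ₗ[R] M) : Prop where
  projective : Module.Projective R P
  surjective : Function.Surjective f
  superfluous : ∀ N : Submodule R P, N ⊔ LinearMap.ker f = ⊤ → N = ⊤

/-- The socle of a module: the sum of its simple submodules. -/
def socle (R : Type u) [Ring R] (M : Type u) [AddCommGroup M] [Module R M] : Submodule R M :=
  sSup {N : Submodule R M | IsSimpleModule R N}

/-- A minimal projective presentation `P₁ → P₀ → M → 0` by finitely generated modules. -/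
structure MinProjPres (R : Type u) [Ring R] (M : Type u) [AddCommGroup M] [Module R M] where
  P₀ : ModuleCat.{u} R
  P₁ : ModuleCat.{u} R
  finite₀ : Module.Finite R P₀
  finite₁ : Module.Finite R P₁
  ε : P₀ →ₗ[R] M
  d : P₁ →ₗ[R] P₀
  cover₀ : IsProjectiveCover ε
  exact : Function.Exact d ε
  cover₁ : IsProjectiveCover d.rangeRestrict

/-- A minimal injective resolution `0 → M → I₀ → I₁ → ⋯`. -/
structure MinInjRes (R : Type u) [Ring R] (M : Type u) [AddCommGroup M] [Module R M] where
  I : ℕ → ModuleCat.{u} R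
  ι : M →ₗ[R] I 0
  d : ∀ n, I n →ₗ[R] I (n + 1)
  injective : ∀ n, Module.Injective R (I n)
  ι_injective : Function.Injective ι
  exact_zero : Function.Exact ι (d 0)
  exact_succ : ∀ n, Function.Exact (d n) (d (n + 1))
  essential_ι : ∀ N : Submodule R (I 0), N ⊓ LinearMap.range ι = ⊥ → N = ⊥
  essential_d : ∀ n, ∀ N : Submodule R (I (n + 1)), N ⊓ LinearMap.range (d n) = ⊥ → N = ⊥

/-- The supremum of all `n` such that `I₀, …, Iₙ₋₁` are projective. -/
noncomputable def MinInjRes.domDim {R : Type u} [Ring R] {M : Type u} [AddCommGroup M] [Module R M]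
    (ρ : MinInjRes R M) : ℕ∞ :=
  ⨆ n : {n : ℕ // ∀ i < n, Module.Projective R (ρ.I i)}, ((n : ℕ) : ℕ∞)

/-- The dominant dimension of a module. Minimal injective resolutions exist and are unique up to
isomorphism, so the supremum is over copies of one and the same value. -/
noncomputable def domDim (R : Type u) [Ring R] (M : Type u) [AddCommGroup M] [Module R M] : ℕ∞ :=
  ⨆ ρ : MinInjRes R M, ρ.domDim

/-- `Extⁱ(X, Y) = 0` for all `i ≥ 1`. -/
def ExtVanish (R : Type u) [Ring R] (X Y : Type u) [AddCommGroup X] [Module R X]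
    [AddCommGroup Y] [Module R Y] : Prop :=
  ∀ i : ℕ, 1 ≤ i →
    Subsingleton (CategoryTheory.Abelian.Ext.{u} (ModuleCat.of R X) (ModuleCat.of R Y) i)

/-! ### The dualities `D = Hom_K(-, K)` and `Tr`

Right `A`-modules are modules over `Aᵐᵒᵖ`, left `A`-modules are modules over `A`. -/

/-- `D(M) = Hom_K(M, K)`, for a left `A`-module `M`. -/
def KDual (K M : Type u) [Field K] [AddCommGroup M] [Module K M] : Type u := M →ₗ[K] K

noncomputable instance (K M : Type u) [Field K] [AddCommGroup M] [Module K M] :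
    AddCommGroup (KDual K M) :=
  inferInstanceAs (AddCommGroup (M →ₗ[K] K))

/-- `D(M)` is a right `A`-module through `(f · a)(x) = f (a x)`. -/
noncomputable instance (K A M : Type u) [Field K] [Ring A] [Algebra K A] [AddCommGroup M]
    [Module K M] [Module A M] [IsScalarTower K A M] : Module Aᵐᵒᵖ (KDual K M) where
  smul a f := LinearMap.comp (show M →ₗ[K] K from f) (Algebra.lsmul K K M a.unop)
  one_smul f := LinearMap.ext fun x => congrArg (show M →ₗ[K] K from f) (one_smul A x)
  mul_smul a b f := LinearMap.ext fun x =>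
    congrArg (show M →ₗ[K] K from f) (mul_smul b.unop a.unop x)
  smul_zero _ := LinearMap.ext fun _ => rfl
  smul_add _ _ _ := LinearMap.ext fun _ => rfl
  add_smul a b f := LinearMap.ext fun x =>
    (congrArg (show M →ₗ[K] K from f) (add_smul a.unop b.unop x)).trans
      (map_add (show M →ₗ[K] K from f) _ _)
  zero_smul f := LinearMap.ext fun x =>
    (congrArg (show M →ₗ[K] K from f) (zero_smul A x)).trans
      (map_zero (show M →ₗ[K] K from f))

/-- For a map `d : P₁ → P₀` of right `A`-modules, the map of left `A`-modules
`Hom_A(P₀, A) → Hom_A(P₁, A)` given by composition with `d`. -/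
def homMap {A : Type u} [Ring A] {P₁ P₀ : Type u} [AddCommGroup P₁] [Module Aᵐᵒᵖ P₁]
    [AddCommGroup P₀] [Module Aᵐᵒᵖ P₀] (d : P₁ →ₗ[Aᵐᵒᵖ] P₀) :
    (P₀ →ₗ[Aᵐᵒᵖ] A) →ₗ[A] (P₁ →ₗ[Aᵐᵒᵖ] A) where
  toFun g := g.comp d
  map_add' _ _ := rfl
  map_smul' _ _ := rfl

/-- The transpose `Tr M = coker (Hom_A(P₀, A) → Hom_A(P₁, A))` of a right `A`-module `M`, computed
from a minimal projective presentation `P₁ → P₀ → M → 0`. It is a left `A`-module. -/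
abbrev MinProjPres.Tr {A : Type u} [Ring A] {M : Type u} [AddCommGroup M] [Module Aᵐᵒᵖ M]
    (π : MinProjPres Aᵐᵒᵖ M) : Type u :=
  (π.P₁ →ₗ[Aᵐᵒᵖ] A) ⧸ LinearMap.range (homMap π.d)

/-- `N ≅ τ(M) = D(Tr M)`, for right `A`-modules `M` and `N`. -/
def IsTau (K A : Type u) [Field K] [Ring A] [Algebra K A] (N M : Type u) [AddCommGroup N]
    [Module Aᵐᵒᵖ N] [AddCommGroup M] [Module Aᵐᵒᵖ M] : Prop :=
  ∃ π : MinProjPres Aᵐᵒᵖ M, Nonempty (N ≃ₗ[Aᵐᵒᵖ] KDual K π.Tr)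

/-! ### Gorenstein projective modules -/

/-- A (finite dimensional) right `A`-module `M` is Gorenstein projective if
`Extⁱ(M, A) = 0 = Extⁱ(Tr M, A)` for all `i ≥ 1`. -/
def IsGorensteinProjective (A : Type u) [Ring A] (M : Type u) [AddCommGroup M]
    [Module Aᵐᵒᵖ M] : Prop :=
  Module.Finite Aᵐᵒᵖ M ∧ ExtVanish Aᵐᵒᵖ M A ∧ ∃ π : MinProjPres Aᵐᵒᵖ M, ExtVanish A π.Tr A

/-- `M` lies in `RGp(A)`: it is Gorenstein projective and has no nonzero projective direct
summand. -/
def InRGp (A : Type u) [Ring A] (M : Type u) [AddCommGroup M] [Module Aᵐᵒᵖ M] : Prop :=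
  IsGorensteinProjective A M ∧
    ∀ N N' : Submodule Aᵐᵒᵖ M, IsCompl N N' → Module.Projective Aᵐᵒᵖ N → N = ⊥

/-- `A` is Gorenstein dominant: the right module `A` has dominant dimension at least one and all
modules in `RGp(A)` have dominant dimension at least two. -/
def IsGorensteinDominant (A : Type u) [Ring A] : Prop :=
  1 ≤ domDim Aᵐᵒᵖ A ∧
    ∀ (M : Type u) [AddCommGroup M] [Module Aᵐᵒᵖ M], InRGp A M → 2 ≤ domDim Aᵐᵒᵖ M

/-- `X` is an indecomposable nonprojective Gorenstein projective module. -/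
def IsIndecNonprojGp (A : Type u) [Ring A] (X : Type u) [AddCommGroup X] [Module Aᵐᵒᵖ X] : Prop :=
  IsIndecomposable Aᵐᵒᵖ X ∧ ¬ Module.Projective Aᵐᵒᵖ X ∧ IsGorensteinProjective A X

/-- `M` lies in the Gorenstein core: it is a finite direct sum of indecomposable nonprojective
Gorenstein projective modules and of projective covers of such modules. -/
def InGorensteinCore (A : Type u) [Ring A] (M : Type u) [AddCommGroup M] [Module Aᵐᵒᵖ M] : Prop :=
  ∃ (m : ℕ) (X : Fin m → ModuleCat.{u} Aᵐᵒᵖ),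
    (∀ k, IsIndecNonprojGp A (X k) ∨
      ∃ (G : ModuleCat.{u} Aᵐᵒᵖ) (f : X k →ₗ[Aᵐᵒᵖ] G),
        IsIndecNonprojGp A G ∧ IsProjectiveCover f) ∧
    Nonempty (M ≃ₗ[Aᵐᵒᵖ] (∀ k, X k))

/-! ### Cyclic Nakayama algebras -/

/-- The right ideal `xA`. -/
abbrev rightIdeal {A : Type u} [Ring A] (x : A) : Submodule Aᵐᵒᵖ A := Submodule.span Aᵐᵒᵖ {x}

/-- The left ideal `Ax`. -/
abbrev leftIdeal {A : Type u} [Ring A] (x : A) : Submodule A A := Submodule.span A {x}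

/-- `dim_K x (J / J²) y`, where `J` is the Jacobson radical of `A`. For primitive idempotents `x`
and `y` of a basic elementary algebra this is the number of arrows from `x` to `y` in the quiver
of `A`. -/
noncomputable def arrowCount (K : Type u) {A : Type u} [Field K] [Ring A] [Algebra K A]
    (x y : A) : ℕ :=
  Module.finrank K
    (((Ring.jacobson A).restrictScalars K).map
      ((((Ring.jacobson A) * (Ring.jacobson A) : Ideal A).restrictScalars K).mkQ ∘ₗ
        LinearMap.mulLeft K x ∘ₗ LinearMap.mulRight K y))

/-- `A` is a basic and elementary Nakayama algebra over `K` with `n` simple modules whose quiver is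
the oriented cycle `0 → 1 → ⋯ → n - 1 → 0`, the vertices being given by the complete set `e` of
primitive orthogonal idempotents. -/
structure IsCNakayama (K : Type u) {A : Type u} [Field K] [Ring A] [Algebra K A] {n : ℕ}
    [NeZero n] (e : ZMod n → A) : Prop where
  finite : Module.Finite K A
  idem : CompleteOrthogonalIdempotents e
  /-- `A / J ≅ Kⁿ`, with `e i` corresponding to the `i`-th unit vector. -/
  elementary : ∃ φ : A →ₐ[K] (ZMod n → K),
    (∀ i, φ (e i) = Pi.single i 1) ∧ RingHom.ker φ = Ring.jacobson A
  /-- The indecomposable projective right modules are uniserial. -/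
  right_uniserial : ∀ i, IsUniserial Aᵐᵒᵖ (rightIdeal (e i))
  /-- The indecomposable projective left modules are uniserial. -/
  left_uniserial : ∀ i, IsUniserial A (leftIdeal (e i))
  quiver : ∀ i j, arrowCount K (e i) (e j) = if j = i + 1 then 1 else 0

/-- The simple right module `Sᵢ = top (eᵢA)` of the vertex `i`. -/
abbrev simpleAt {A : Type u} [Ring A] {n : ℕ} (e : ZMod n → A) (i : ZMod n) : Type u :=
  rightIdeal (e i) ⧸ Module.jacobson Aᵐᵒᵖ (rightIdeal (e i))

/-- There is an arrow from `i` to `j` in the resolution quiver: `Sⱼ ≅ τ(soc P(Sᵢ))`. -/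
def ResArrow (K : Type u) {A : Type u} [Field K] [Ring A] [Algebra K A] {n : ℕ}
    (e : ZMod n → A) (i j : ZMod n) : Prop :=
  ∃ (P : ModuleCat.{u} Aᵐᵒᵖ) (f : P →ₗ[Aᵐᵒᵖ] simpleAt e i),
    IsProjectiveCover f ∧ IsTau K A (simpleAt e j) (socle Aᵐᵒᵖ P)

/-- The vertex `i` is black: `Sᵢ` has projective dimension at least two. -/
def IsBlack {A : Type u} [Ring A] {n : ℕ} (e : ZMod n → A) (i : ZMod n) : Prop :=
  2 ≤ CategoryTheory.projectiveDimension (ModuleCat.of Aᵐᵒᵖ (simpleAt e i))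

/-- The vertex `i` is cyclically black: it lies on a cycle `i = v 0 → v 1 → ⋯ → v m = i` of the
resolution quiver all of whose vertices are black. -/
def IsCyclicallyBlack (K : Type u) {A : Type u} [Field K] [Ring A] [Algebra K A] {n : ℕ}
    (e : ZMod n → A) (i : ZMod n) : Prop :=
  ∃ (m : ℕ) (v : ℕ → ZMod n), 1 ≤ m ∧ v 0 = i ∧ v m = i ∧
    ∀ k < m, ResArrow K e (v k) (v (k + 1)) ∧ IsBlack e (v k)

end Nak

/-!
Call `j` a socle vertex of a right module `X` if the simple module `S_j` embeds in `X`. If `j` is a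
socle vertex of `A`, then the product pairs the indecomposable projective right module with socle
`S_j` perfectly with `A e_j`, so that `D (A e_j)` is projective. Hence a module cogenerated by `A`
has a projective injective hull, being embedded in a power of the projective modules `D (A e_j)`.

If `j` is not a socle vertex of `A`, right multiplication by the arrow `α : j → j + 1` is injective
on `A e_j`. Evaluating maps `X → A` at `x e_{j+1}` and dividing by `α` shows, for `X` reflexive
without projective summands, that `x e_{j+1}` is divisible by `α`: so `S_{j+1}` is not in the top
of `X`. This is what keeps `S_j` out of the socle of the cokernel of the injective hull of `X`,
hence makes the second term of the minimal injective resolution of `X` projective too.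

If `S_i` is the translate `τ` of the socle `S` of a projective module, then `e_i A` is a summand of
the projective cover of `Ω S`, so that `i - 1` is a vertex of `S` and hence a socle vertex of `A`.
-/

namespace Nak

section InjectiveHulls

variable {R : Type u} [Ring R]

theorem injective_of_retract {E I : Type u} [AddCommGroup E] [Module R E] [AddCommGroup I]
    [Module R I] [Module.Injective R I] (i : E →ₗ[R] I) (p : I →ₗ[R] E)
    (hpi : p ∘ₗ i = LinearMap.id) : Module.Injective R E where
  out X Y _ _ _ _ f hf g := by
    obtain ⟨k, hk⟩ := Module.Injective.out f hf (i ∘ₗ g)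
    exact ⟨p ∘ₗ k, fun x => by
      rw [LinearMap.comp_apply, hk]
      exact LinearMap.congr_fun hpi (g x)⟩

/-- The submodule `E` is an essential extension of the submodule `X`. -/
def IsEssentialExtension {M : Type u} [AddCommGroup M] [Module R M] (X E : Submodule R M) : Prop :=
  X ≤ E ∧ ∀ L ≤ E, L ⊓ X = ⊥ → L = ⊥

section

variable {M : Type u} [AddCommGroup M] [Module R M]

theorem exists_maximal_isEssentialExtension (X : Submodule R M) :
    ∃ E, Maximal (IsEssentialExtension X) E := by
  obtain ⟨E, -, hE⟩ := zorn_le_nonempty₀ {E | IsEssentialExtension X E}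
    (fun c hc hchain Y hY => ⟨sSup c, ⟨(hc hY).1.trans (le_sSup hY), fun L hL hLX => by
      rw [← inf_eq_left.2 hL, DirectedOn.inf_sSup_eq hchain.directedOn]
      refine iSup₂_eq_bot.2 fun Z hZ => (hc hZ).2 _ inf_le_right ?_
      exact eq_bot_mono (inf_le_inf_right X inf_le_left) hLX⟩, fun Z => le_sSup⟩)
    X ⟨le_rfl, fun L hL hLX => by rwa [inf_eq_left.2 hL] at hLX⟩
  exact ⟨E, hE⟩

theorem exists_maximal_disjoint (E : Submodule R M) : ∃ C, Maximal (Disjoint E) C := by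
  obtain ⟨C, -, hC⟩ := zorn_le_nonempty₀ {C : Submodule R M | Disjoint E C}
    (fun c hc hchain Y _ => ⟨sSup c, hchain.directedOn.disjoint_sSup_right.2 fun _ h => hc h,
      fun Z => le_sSup⟩)
    ⊥ disjoint_bot_right
  exact ⟨C, hC⟩

theorem eq_bot_of_inf_map_mkQ_eq_bot {E C : Submodule R M} (hC : Maximal (Disjoint E) C)
    {L : Submodule R (M ⧸ C)} (hL : L ⊓ E.map C.mkQ = ⊥) : L = ⊥ := by
  have hdisj : Disjoint E (L.comap C.mkQ) := by
    refine Submodule.disjoint_def.2 fun x hxE hxL => ?_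
    have hx : C.mkQ x ∈ L ⊓ E.map C.mkQ := ⟨hxL, x, hxE, rfl⟩
    rw [hL, Submodule.mem_bot, Submodule.mkQ_apply, Submodule.Quotient.mk_eq_zero] at hx
    exact Submodule.disjoint_def.1 hC.prop x hxE hx
  have hLC : L.comap C.mkQ ≤ C := hC.le_of_ge hdisj (Submodule.le_comap_mkQ C L)
  rw [← Submodule.map_comap_eq_of_surjective C.mkQ_surjective L, ← le_bot_iff,
    Submodule.map_le_iff_le_comap, Submodule.comap_bot, Submodule.ker_mkQ]
  exact hLC

/-- With `C` maximal among the submodules disjoint from `E`, the map `g : M ⧸ C → M` that extends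
`E ↪ M` along the essential embedding `E ↪ M ⧸ C` has range `E` by maximality of `E`. -/
theorem injective_of_maximal_isEssentialExtension [Module.Injective R M] {X E : Submodule R M}
    (hE : Maximal (IsEssentialExtension X) E) : Module.Injective R E := by
  obtain ⟨C, hC⟩ := exists_maximal_disjoint E
  have hinj : Function.Injective (C.mkQ ∘ₗ E.subtype) := by
    rw [← LinearMap.ker_eq_bot, LinearMap.ker_comp, Submodule.ker_mkQ,
      ← Submodule.disjoint_iff_comap_eq_bot]
    exact hC.prop
  obtain ⟨g, hg⟩ := Module.Injective.out _ hinj E.subtype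
  have hEg : E ≤ LinearMap.range g := fun x hx => ⟨_, hg ⟨x, hx⟩⟩
  have hess : IsEssentialExtension X (LinearMap.range g) := by
    refine ⟨hE.prop.1.trans hEg, fun L hL hLX => ?_⟩
    have hLE : L ⊓ E = ⊥ :=
      hE.prop.2 _ inf_le_right (eq_bot_mono (inf_le_inf_right X inf_le_left) hLX)
    have hcomap : L.comap g = ⊥ := by
      refine eq_bot_of_inf_map_mkQ_eq_bot hC (eq_bot_iff.2 ?_)
      rintro _ ⟨hxL, x, hxE, rfl⟩
      have hgx : g (C.mkQ x) = x := hg ⟨x, hxE⟩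
      have hx : x ∈ L ⊓ E := ⟨hgx ▸ hxL, hxE⟩
      rw [hLE, Submodule.mem_bot] at hx
      rw [hx, map_zero]
      exact Submodule.zero_mem ⊥
    rw [← Submodule.map_comap_eq_of_le hL, hcomap, Submodule.map_bot]
  have hgE : LinearMap.range g ≤ E := hE.le_of_ge hess hEg
  exact injective_of_retract E.subtype
    ((g ∘ₗ C.mkQ).codRestrict E fun x => hgE ⟨C.mkQ x, rfl⟩)
    (LinearMap.ext fun x => Subtype.ext (hg x))

end

section

variable (M : Type u) [AddCommGroup M] [Module R M]

theorem exists_injective_embedding :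
    ∃ (I : ModuleCat.{u} R) (j : M →ₗ[R] I), Module.Injective R I ∧ Function.Injective j := by
  obtain ⟨I, hI, j, hj⟩ :=
    (CategoryTheory.EnoughInjectives.presentation (ModuleCat.of R M)).some
  exact ⟨I, j.hom, Module.injective_module_of_injective_object R I,
    (ModuleCat.mono_iff_injective j).1 hj⟩

theorem exists_injective_hull :
    ∃ (E : ModuleCat.{u} R) (ι : M →ₗ[R] E), Module.Injective R E ∧ Function.Injective ι ∧
      ∀ N : Submodule R E, N ⊓ LinearMap.range ι = ⊥ → N = ⊥ := by
  obtain ⟨I, j, hI, hj⟩ := exists_injective_embedding (R := R) M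
  obtain ⟨E, hE⟩ := exists_maximal_isEssentialExtension (LinearMap.range j)
  have hjE : ∀ m, j m ∈ E := fun m => hE.prop.1 ⟨m, rfl⟩
  refine ⟨ModuleCat.of R E, j.codRestrict E hjE, injective_of_maximal_isEssentialExtension hE,
    fun a b hab => hj (congrArg Subtype.val hab), fun N hN => ?_⟩
  refine Submodule.map_injective_of_injective E.subtype_injective
    ((hE.prop.2 (N.map E.subtype) (Submodule.map_subtype_le E N) ?_).trans
      (Submodule.map_bot E.subtype).symm)
  rw [eq_bot_iff] at hN ⊢
  rintro _ ⟨⟨x, hxN, rfl⟩, m, hm⟩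
  exact congrArg Subtype.val (hN ⟨hxN, m, Subtype.ext hm⟩)

variable (R) in
/-- An injective hull of a module. -/
noncomputable def hull : ModuleCat.{u} R :=
  (exists_injective_hull (R := R) M).choose

variable (R) in
/-- The embedding of a module into its injective hull. -/
noncomputable def hullι : M →ₗ[R] hull R M :=
  (exists_injective_hull (R := R) M).choose_spec.choose

instance hull_injective : Module.Injective R (hull R M) :=
  (exists_injective_hull (R := R) M).choose_spec.choose_spec.1

theorem hullι_injective : Function.Injective (hullι R M) :=
  (exists_injective_hull (R := R) M).choose_spec.choose_spec.2.1

theorem hullι_essential (N : Submodule R (hull R M)) (hN : N ⊓ LinearMap.range (hullι R M) = ⊥) :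
    N = ⊥ :=
  (exists_injective_hull (R := R) M).choose_spec.choose_spec.2.2 N hN

variable {M} in
theorem exists_retract_hull {F : Type u} [AddCommGroup F] [Module R F] [Module.Injective R F]
    (f : M →ₗ[R] F) (hf : Function.Injective f) :
    ∃ (i : hull R M →ₗ[R] F) (p : F →ₗ[R] hull R M), p ∘ₗ i = LinearMap.id := by
  obtain ⟨i, hi⟩ := Module.Injective.out (hullι R M) (hullι_injective M) f
  have hker : LinearMap.ker i = ⊥ := by
    refine hullι_essential M _ (eq_bot_iff.2 ?_)
    rintro _ ⟨hx, m, rfl⟩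
    have hfm : f m = 0 := (hi m).symm.trans hx
    rw [(map_eq_zero_iff f hf).1 hfm, map_zero]
    exact Submodule.zero_mem ⊥
  obtain ⟨p, hp⟩ := Module.Injective.out i (LinearMap.ker_eq_bot.1 hker) LinearMap.id
  exact ⟨i, p, LinearMap.ext hp⟩

end

/-- The iterated cosyzygies of a module. -/
noncomputable def cosyzygy (M : ModuleCat.{u} R) : ℕ → ModuleCat.{u} R
  | 0 => M
  | n + 1 => ModuleCat.of R
      (hull R (cosyzygy M n) ⧸ LinearMap.range (hullι R (cosyzygy M n)))

/-- The projection from the injective hull of a cosyzygy to the next cosyzygy. -/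
noncomputable def cosyzygyMk (M : ModuleCat.{u} R) (n : ℕ) :
    hull R (cosyzygy M n) →ₗ[R] cosyzygy M (n + 1) :=
  Submodule.mkQ (LinearMap.range (hullι R (cosyzygy M n)))

theorem cosyzygyMk_surjective (M : ModuleCat.{u} R) (n : ℕ) :
    Function.Surjective (cosyzygyMk M n) :=
  Submodule.mkQ_surjective (LinearMap.range (hullι R (cosyzygy M n)))

theorem exact_hullι_cosyzygy (M : ModuleCat.{u} R) (n : ℕ) :
    Function.Exact (hullι R (cosyzygy M n))
      (hullι R (cosyzygy M (n + 1)) ∘ₗ cosyzygyMk M n) :=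
  (Function.Injective.comp_exact_iff_exact (hullι_injective _)).2
    (LinearMap.exact_map_mkQ_range (hullι R (cosyzygy M n)))

variable (R) in
/-- The minimal injective resolution of a module that is built from injective hulls. -/
noncomputable def minInjRes (M : Type u) [AddCommGroup M] [Module R M] : MinInjRes R M where
  I n := hull R (cosyzygy (ModuleCat.of R M) n)
  ι := hullι R M
  d n := hullι R (cosyzygy (ModuleCat.of R M) (n + 1)) ∘ₗ cosyzygyMk _ n
  injective _ := hull_injective _
  ι_injective := hullι_injective M
  exact_zero := exact_hullι_cosyzygy (ModuleCat.of R M) 0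
  exact_succ n := (Function.Surjective.comp_exact_iff_exact (cosyzygyMk_surjective _ n)).2
    (exact_hullι_cosyzygy _ (n + 1))
  essential_ι := hullι_essential M
  essential_d n N hN := by
    rw [LinearMap.range_comp_of_range_eq_top _
      (LinearMap.range_eq_top.2 (cosyzygyMk_surjective _ n))] at hN
    exact hullι_essential _ N hN

theorem le_domDim {M : Type u} [AddCommGroup M] [Module R M] {n : ℕ} (ρ : MinInjRes R M)
    (h : ∀ i < n, Module.Projective R (ρ.I i)) : n ≤ domDim R M :=
  le_trans (le_iSup (fun m : {m : ℕ // ∀ i < m, Module.Projective R (ρ.I i)} => ((m : ℕ) : ℕ∞))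
    ⟨n, h⟩) (le_iSup (fun ρ : MinInjRes R M => ρ.domDim) ρ)

theorem one_le_domDim (M : Type u) [AddCommGroup M] [Module R M]
    (h₀ : Module.Projective R (hull R M)) : 1 ≤ domDim R M :=
  le_domDim (n := 1) (minInjRes R M) fun i hi => by
    obtain rfl : i = 0 := Nat.lt_one_iff.1 hi
    exact h₀

theorem two_le_domDim (M : Type u) [AddCommGroup M] [Module R M]
    (h₀ : Module.Projective R (hull R M))
    (h₁ : Module.Projective R (hull R (hull R M ⧸ LinearMap.range (hullι R M)))) :
    2 ≤ domDim R M :=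
  le_domDim (n := 2) (minInjRes R M) fun i hi => by
    obtain rfl | rfl : i = 0 ∨ i = 1 := by lia
    · exact h₀
    · exact h₁

end InjectiveHulls

section Cogeneration

variable {R : Type u} [Ring R]

/-- The points of `X` are separated by the homomorphisms from `X` to `F`. -/
def IsCogenerated (R F X : Type u) [Ring R] [AddCommGroup F] [Module R F] [AddCommGroup X]
    [Module R X] : Prop :=
  ∀ x : X, x ≠ 0 → ∃ f : X →ₗ[R] F, f x ≠ 0

theorem projective_pi {ι : Type*} [Finite ι] (F : ι → Type*) [∀ i, AddCommGroup (F i)]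
    [∀ i, Module R (F i)] [∀ i, Module.Projective R (F i)] : Module.Projective R (∀ i, F i) := by
  classical
  cases nonempty_fintype ι
  exact Module.Projective.of_equiv DFinsupp.linearEquivFunOnFintype

variable {F X : Type u} [AddCommGroup F] [Module R F] [AddCommGroup X] [Module R X]

theorem isCogenerated_pi {m : ℕ} {X : Fin m → Type u} [∀ k, AddCommGroup (X k)]
    [∀ k, Module R (X k)] (h : ∀ k, IsCogenerated R F (X k)) : IsCogenerated R F (∀ k, X k) := by
  intro x hx
  obtain ⟨k, hk⟩ := Function.ne_iff.1 hx
  obtain ⟨f, hf⟩ := h k (x k) hk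
  exact ⟨f ∘ₗ LinearMap.proj k, hf⟩

theorem IsCogenerated.of_injective {Y : Type u} [AddCommGroup Y] [Module R Y]
    (h : IsCogenerated R F X) {i : Y →ₗ[R] X} (hi : Function.Injective i) :
    IsCogenerated R F Y := by
  intro y hy
  obtain ⟨f, hf⟩ := h (i y) ((map_ne_zero_iff i hi).2 hy)
  exact ⟨f ∘ₗ i, hf⟩

theorem IsCogenerated.exists_injective_pi [IsArtinian R X] (h : IsCogenerated R F X) :
    ∃ (s : Finset (X →ₗ[R] F)) (f : X →ₗ[R] (s → F)), Function.Injective f := by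
  obtain ⟨s, hs⟩ := Finset.exists_inf_le fun f : X →ₗ[R] F => LinearMap.ker f
  refine ⟨s, LinearMap.pi fun f => f.1, (injective_iff_map_eq_zero _).2 fun x hx => ?_⟩
  have hx' : x ∈ s.inf fun f : X →ₗ[R] F => LinearMap.ker f :=
    Submodule.mem_finsetInf.2 fun f hf => congrFun hx ⟨f, hf⟩
  by_contra hx0
  obtain ⟨f, hf⟩ := h x hx0
  exact hf (hs f hx')

theorem IsCogenerated.projective_hull [IsArtinian R X] [Module.Injective R F]
    [Module.Projective R F] (h : IsCogenerated R F X) : Module.Projective R (hull R X) := by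
  obtain ⟨s, f, hf⟩ := h.exists_injective_pi
  obtain ⟨i, p, hpi⟩ := exists_retract_hull f hf
  have := projective_pi (R := R) fun _ : s => F
  exact Module.Projective.of_split i p hpi

theorem IsCogenerated.finite_hull [IsArtinian R X] [Module.Injective R F]
    [Module.Finite R F] (h : IsCogenerated R F X) : Module.Finite R (hull R X) := by
  obtain ⟨s, f, hf⟩ := h.exists_injective_pi
  obtain ⟨i, p, hpi⟩ := exists_retract_hull f hf
  exact Module.Finite.of_surjective p fun x => ⟨i x, LinearMap.congr_fun hpi x⟩

end Cogeneration

section Duals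

variable {A : Type u} [Ring A]

variable (A) in
/-- The isomorphism of right `A`-modules from `Aᵐᵒᵖ`, a free module of rank one by definition,
to `A`. -/
def unopEquiv : Aᵐᵒᵖ ≃ₗ[Aᵐᵒᵖ] A where
  toFun := MulOpposite.unop
  invFun := MulOpposite.op
  map_add' _ _ := rfl
  map_smul' _ _ := rfl

instance : Module.Projective Aᵐᵒᵖ A := Module.Projective.of_equiv (unopEquiv A)

instance : Module.Finite Aᵐᵒᵖ A := Module.Finite.equiv (unopEquiv A)

theorem isCogenerated_of_projective (P : Type u) [AddCommGroup P] [Module Aᵐᵒᵖ P]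
    [Module.Projective Aᵐᵒᵖ P] : IsCogenerated Aᵐᵒᵖ A P := fun _ hp =>
  have ⟨f, hf⟩ := Module.Projective.exists_dual_ne_zero Aᵐᵒᵖ hp
  ⟨(unopEquiv A).toLinearMap ∘ₗ f, (unopEquiv A).map_ne_zero_iff.2 hf⟩

/-- A right `A`-module `M` is reflexive if evaluation `M → Hom_A(Hom_A(M, A), A)` is bijective. -/
def IsReflexive (A M : Type u) [Ring A] [AddCommGroup M] [Module Aᵐᵒᵖ M] : Prop :=
  Function.Bijective (LinearMap.applyₗ' A : M →+ (M →ₗ[Aᵐᵒᵖ] A) →ₗ[A] A)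

theorem IsReflexive.isCogenerated {M : Type u} [AddCommGroup M] [Module Aᵐᵒᵖ M]
    (hM : IsReflexive A M) : IsCogenerated Aᵐᵒᵖ A M := by
  intro x hx
  by_contra! h
  exact hx ((injective_iff_map_eq_zero _).1 hM.injective x (LinearMap.ext h))

section Projective

variable (P : Type u) [AddCommGroup P] [Module Aᵐᵒᵖ P] [Module.Finite Aᵐᵒᵖ P]
  [Module.Projective Aᵐᵒᵖ P]

theorem exists_dual_basis : ∃ (k : ℕ) (x : Fin k → P) (f : Fin k → P →ₗ[Aᵐᵒᵖ] A),
    ∀ p, ∑ i, MulOpposite.op (f i p) • x i = p := by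
  obtain ⟨k, g, s, -, -, hgs⟩ := Module.Finite.exists_comp_eq_id_of_projective Aᵐᵒᵖ P
  refine ⟨k, fun i => g (Pi.single i 1),
    fun i => (unopEquiv A).toLinearMap ∘ₗ LinearMap.proj i ∘ₗ s, fun p => ?_⟩
  conv_rhs => rw [← LinearMap.id_apply (R := Aᵐᵒᵖ) p, ← hgs, LinearMap.comp_apply,
    ← LinearMap.sum_single_apply _ (s p), map_sum]
  refine Finset.sum_congr rfl fun i _ => ?_
  rw [← map_smul, ← Pi.single_smul, smul_eq_mul, mul_one]
  rfl

theorem exists_dual_basis_dual : ∃ (k : ℕ) (x : Fin k → P) (f : Fin k → P →ₗ[Aᵐᵒᵖ] A),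
    ∀ g : P →ₗ[Aᵐᵒᵖ] A, ∑ i, g (x i) • f i = g := by
  obtain ⟨k, x, f, hf⟩ := exists_dual_basis (A := A) P
  refine ⟨k, x, f, fun g => LinearMap.ext fun p => ?_⟩
  conv_rhs => rw [← hf p, map_sum]
  rw [LinearMap.sum_apply]
  exact Finset.sum_congr rfl fun i _ => (map_smul g _ _).symm

theorem isReflexive_of_projective : IsReflexive A P := by
  refine ⟨(injective_iff_map_eq_zero _).2 fun p hp => ?_, fun Λ => ?_⟩
  · by_contra hp0
    obtain ⟨f, hf⟩ := isCogenerated_of_projective (A := A) P p hp0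
    exact hf (LinearMap.congr_fun hp f)
  · obtain ⟨k, x, f, hf⟩ := exists_dual_basis_dual (A := A) P
    refine ⟨∑ i, MulOpposite.op (Λ (f i)) • x i, LinearMap.ext fun g => ?_⟩
    conv_rhs => rw [← hf g, map_sum]
    exact (map_sum g _ _).trans (Finset.sum_congr rfl fun i _ =>
      (map_smul g _ _).trans (map_smul Λ _ _).symm)

theorem projective_dual : Module.Projective A (P →ₗ[Aᵐᵒᵖ] A) := by
  obtain ⟨k, x, f, hf⟩ := exists_dual_basis_dual (A := A) P
  exact Module.Projective.of_split (M := Fin k → A)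
    (LinearMap.pi fun i => LinearMap.applyₗ' A (x i))
    (Fintype.linearCombination A f) (LinearMap.ext hf)

theorem mem_jacobson_dual {g : P →ₗ[Aᵐᵒᵖ] A} (hg : ∀ p, g p ∈ Ring.jacobson A) :
    g ∈ Module.jacobson A (P →ₗ[Aᵐᵒᵖ] A) := by
  obtain ⟨k, x, f, hf⟩ := exists_dual_basis_dual (A := A) P
  rw [← hf g]
  exact Submodule.sum_mem _ fun i _ =>
    Ring.jacobson_smul_top_le A _ (Submodule.smul_mem_smul (hg (x i)) Submodule.mem_top)

end Projective

end Duals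

section GorensteinProjective

open CategoryTheory

section ExtensionOfMaps

variable {A : Type u} [Ring A] {X P T Y : Type u} [AddCommGroup X] [Module A X]
  [AddCommGroup P] [Module A P] [AddCommGroup T] [Module A T] [AddCommGroup Y] [Module A Y]
  {f : X →ₗ[A] P} {g : P →ₗ[A] T}

theorem shortExact_of_exact (hf : Function.Injective f) (hfg : Function.Exact f g)
    (hg : Function.Surjective g) :
    (ShortComplex.mk (ModuleCat.ofHom f) (ModuleCat.ofHom g)
      (by ext x; exact hfg.apply_apply_eq_zero x)).ShortExact where
  exact := (ShortComplex.ShortExact.moduleCat_exact_iff_function_exact _).2 hfg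
  mono_f := (ModuleCat.mono_iff_injective _).2 hf
  epi_g := (ModuleCat.epi_iff_surjective _).2 hg

theorem exists_comp_eq_of_ext_one (hf : Function.Injective f) (hfg : Function.Exact f g)
    (hg : Function.Surjective g)
    (h : Subsingleton (Abelian.Ext.{u} (ModuleCat.of A T) (ModuleCat.of A Y) 1))
    (k : X →ₗ[A] Y) : ∃ l : P →ₗ[A] Y, l ∘ₗ f = k := by
  obtain ⟨x, hx⟩ := Abelian.Ext.contravariant_sequence_exact₁ (shortExact_of_exact hf hfg hg)
    (ModuleCat.of A Y) (Abelian.Ext.mk₀ (ModuleCat.ofHom k)) (n₁ := 1) rfl (Subsingleton.elim _ _)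
  obtain ⟨l, rfl⟩ := (Abelian.Ext.mk₀_bijective _ _).2 x
  rw [Abelian.Ext.mk₀_comp_mk₀] at hx
  exact ⟨l.hom, congrArg ModuleCat.Hom.hom ((Abelian.Ext.mk₀_bijective _ _).1 hx)⟩

theorem exists_comp_eq_of_ker_le
    (h : Subsingleton (Abelian.Ext.{u} (ModuleCat.of A (P ⧸ LinearMap.range f))
      (ModuleCat.of A Y) 1))
    (k : X →ₗ[A] Y) (hk : LinearMap.ker f ≤ LinearMap.ker k) : ∃ l : P →ₗ[A] Y, l ∘ₗ f = k := by
  have hexact : Function.Exact ((LinearMap.ker f).liftQ f le_rfl) (LinearMap.range f).mkQ := by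
    rw [LinearMap.exact_iff, Submodule.ker_mkQ, Submodule.range_liftQ]
  obtain ⟨l, hl⟩ := exists_comp_eq_of_ext_one
    (LinearMap.ker_eq_bot.1 (Submodule.ker_liftQ_eq_bot _ f le_rfl le_rfl)) hexact
    (Submodule.mkQ_surjective _) h ((LinearMap.ker f).liftQ k hk)
  refine ⟨l, ?_⟩
  rw [← Submodule.liftQ_mkQ (LinearMap.ker f) k hk, ← hl, LinearMap.comp_assoc,
    Submodule.liftQ_mkQ]

theorem subsingleton_ext_of_exact (hf : Function.Injective f) (hfg : Function.Exact f g)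
    (hg : Function.Surjective g) [Module.Projective A P] (n : ℕ)
    (h : Subsingleton (Abelian.Ext.{u} (ModuleCat.of A T) (ModuleCat.of A Y) (n + 2))) :
    Subsingleton (Abelian.Ext.{u} (ModuleCat.of A X) (ModuleCat.of A Y) (n + 1)) := by
  refine subsingleton_of_forall_eq 0 fun x => ?_
  have : Projective (ModuleCat.of A P) := inferInstance
  obtain ⟨y, rfl⟩ := Abelian.Ext.contravariant_sequence_exact₁ (shortExact_of_exact hf hfg hg)
    (ModuleCat.of A Y) x (n₁ := n + 2) (by lia) (Subsingleton.elim _ _)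
  rw [Abelian.Ext.eq_zero_of_projective y, Abelian.Ext.comp_zero]

end ExtensionOfMaps

variable {A : Type u} [Ring A] {M P₀ P₁ : Type u} [AddCommGroup M] [Module Aᵐᵒᵖ M]
  [AddCommGroup P₀] [Module Aᵐᵒᵖ P₀] [AddCommGroup P₁] [Module Aᵐᵒᵖ P₁] {d : P₁ →ₗ[Aᵐᵒᵖ] P₀}
  {ε : P₀ →ₗ[Aᵐᵒᵖ] M}

theorem homMap_injective (hε : Function.Surjective ε) : Function.Injective (homMap ε) :=
  fun _ _ h => LinearMap.cancel_right hε |>.1 h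

theorem homMap_exact (hdε : Function.Exact d ε) (hε : Function.Surjective ε) :
    Function.Exact (homMap ε) (homMap d) := by
  refine fun g => ⟨fun hg => ?_, ?_⟩
  · have hle : LinearMap.ker ε ≤ LinearMap.ker g := by
      rintro p hp
      obtain ⟨q, rfl⟩ := (hdε p).1 hp
      exact LinearMap.congr_fun hg q
    refine ⟨(LinearMap.ker ε).liftQ g hle ∘ₗ (ε.quotKerEquivOfSurjective hε).symm.toLinearMap,
      LinearMap.ext fun p => ?_⟩
    have hp : (ε.quotKerEquivOfSurjective hε).symm (ε p) = Submodule.Quotient.mk p := by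
      rw [LinearEquiv.symm_apply_eq]
      rfl
    exact congrArg ((LinearMap.ker ε).liftQ g hle) hp
  · rintro ⟨h, rfl⟩
    exact LinearMap.ext fun q => (congrArg h (hdε.apply_apply_eq_zero q)).trans h.map_zero

variable [Module.Finite Aᵐᵒᵖ P₀] [Module.Projective Aᵐᵒᵖ P₀] [Module.Finite Aᵐᵒᵖ P₁]
  [Module.Projective Aᵐᵒᵖ P₁]

/-- If `Extⁱ(Tr M, A)` vanishes for `i = 1` and `i = 2`, then every functional on `M* ⊆ P₀*`
extends to `P₀*`, and every functional on `P₀*` that vanishes on `M*` extends to `P₁*`; both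
extensions are evaluations because `P₀` and `P₁` are reflexive. -/
theorem isReflexive_of_subsingleton_ext (hdε : Function.Exact d ε) (hε : Function.Surjective ε)
    (h₁ : Subsingleton (Abelian.Ext.{u}
      (ModuleCat.of A ((P₁ →ₗ[Aᵐᵒᵖ] A) ⧸ LinearMap.range (homMap d))) (ModuleCat.of A A) 1))
    (h₂ : Subsingleton (Abelian.Ext.{u}
      (ModuleCat.of A ((P₁ →ₗ[Aᵐᵒᵖ] A) ⧸ LinearMap.range (homMap d))) (ModuleCat.of A A) 2)) :
    IsReflexive A M := by
  refine ⟨(injective_iff_map_eq_zero _).2 fun m hm => ?_, fun Λ => ?_⟩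
  · obtain ⟨p, rfl⟩ := hε m
    have hker : LinearMap.ker (homMap d) ≤ LinearMap.ker (LinearMap.applyₗ' A p) := by
      intro f hf
      obtain ⟨g, rfl⟩ := (homMap_exact hdε hε f).1 hf
      exact LinearMap.congr_fun hm g
    obtain ⟨l, hl⟩ := exists_comp_eq_of_ker_le h₁ _ hker
    obtain ⟨q, rfl⟩ := (isReflexive_of_projective P₁).surjective l
    rw [← (isReflexive_of_projective P₀).injective hl]
    exact hdε.apply_apply_eq_zero q
  · have := projective_dual (A := A) P₁
    have hrange := subsingleton_ext_of_exact (Submodule.subtype_injective _)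
      (LinearMap.exact_subtype_mkQ (LinearMap.range (homMap d))) (Submodule.mkQ_surjective _) 0 h₂
    have hexact : Function.Exact (homMap (A := A) ε) (homMap d).rangeRestrict := by
      rw [LinearMap.exact_iff, LinearMap.ker_rangeRestrict]
      exact (homMap_exact hdε hε).linearMap_ker_eq
    obtain ⟨l, hl⟩ := exists_comp_eq_of_ext_one (homMap_injective hε) hexact
      (LinearMap.surjective_rangeRestrict _) hrange Λ
    obtain ⟨p, rfl⟩ := (isReflexive_of_projective P₀).surjective l
    exact ⟨ε p, hl⟩

theorem IsGorensteinProjective.isReflexive (hM : IsGorensteinProjective A M) :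
    IsReflexive A M := by
  obtain ⟨-, -, π, hπ⟩ := hM
  have := π.finite₀
  have := π.finite₁
  have := π.cover₀.projective
  have := π.cover₁.projective
  exact isReflexive_of_subsingleton_ext π.exact π.cover₀.surjective (hπ 1 le_rfl)
    (hπ 2 one_le_two)

end GorensteinProjective

open MulOpposite

section Radical

variable {R : Type u} [Ring R] {M : Type u} [AddCommGroup M] [Module R M]

theorem isUnit_one_add_of_mem_jacobson {x : R} (hx : x ∈ Ring.jacobson R) : IsUnit (1 + x) := by
  have left_inv : ∀ y ∈ Ring.jacobson R, ∃ z, z * (1 + y) = 1 := fun y hy => by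
    rw [← Ideal.jacobson_bot, Ideal.mem_jacobson_iff] at hy
    obtain ⟨z, hz⟩ := hy 1
    rw [mul_one, Submodule.mem_bot, sub_eq_zero, add_comm] at hz
    exact ⟨z, by rw [mul_add, mul_one, hz]⟩
  obtain ⟨z, hz⟩ := left_inv x hx
  obtain ⟨w, hw⟩ := left_inv (-(z * x)) (neg_mem (Ideal.mul_mem_left _ z hx))
  have hz' : 1 + -(z * x) = z := by rw [← hz]; noncomm_ring
  rw [hz'] at hw
  exact ⟨⟨1 + x, z, left_inv_eq_right_inv hw hz ▸ hw, hz⟩, rfl⟩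

theorem mem_jacobson_iff_forall_isUnit {x : R} :
    x ∈ Ring.jacobson R ↔ ∀ y, IsUnit (1 + y * x) := by
  refine ⟨fun hx y => isUnit_one_add_of_mem_jacobson (Ideal.mul_mem_left _ y hx), fun h => ?_⟩
  rw [← Ideal.jacobson_bot, Ideal.mem_jacobson_iff]
  intro y
  obtain ⟨z, hz⟩ := (h y).exists_left_inv
  refine ⟨z, (Submodule.mem_bot R).2 ?_⟩
  rw [← hz]
  noncomm_ring

theorem op_mem_jacobson {x : R} : op x ∈ Ring.jacobson Rᵐᵒᵖ ↔ x ∈ Ring.jacobson R := by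
  constructor <;> refine fun hx => mem_jacobson_iff_forall_isUnit.2 fun y => ?_
  · exact isUnit_op.1 (isUnit_one_add_of_mem_jacobson (Ideal.mul_mem_right (op y) _ hx))
  · exact isUnit_unop.1 (isUnit_one_add_of_mem_jacobson (Ideal.mul_mem_right (unop y) _ hx))

theorem op_smul_mem_jacobson {X : Type u} [AddCommGroup X] [Module Rᵐᵒᵖ X] {x : R}
    (hx : x ∈ Ring.jacobson R) (m : X) : op x • m ∈ Module.jacobson Rᵐᵒᵖ X :=
  Ring.jacobson_smul_top_le Rᵐᵒᵖ X <|
    Submodule.smul_mem_smul (op_mem_jacobson.2 hx) Submodule.mem_top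

theorem jacobson_eq_jacobson_smul_top [IsArtinianRing R] :
    Module.jacobson R M = Ring.jacobson R • (⊤ : Submodule R M) := by
  refine (Module.jacobson_le_of_eq_bot ?_).antisymm (Ring.jacobson_smul_top_le R M)
  have htors := Module.isTorsionBySet_quotient_ideal_smul M (Ring.jacobson R)
  let _ := htors.module
  have : IsSemisimpleModule R (M ⧸ Ring.jacobson R • (⊤ : Submodule R M)) :=
    htors.isSemisimpleModule_iff.1 inferInstance
  exact IsSemisimpleModule.jacobson_eq_bot R _

theorem exists_smul_ne_zero_jacobson_smul_eq_zero [IsArtinianRing R] {x : M} (hx : x ≠ 0) :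
    ∃ r : R, r • x ≠ 0 ∧ ∀ j ∈ Ring.jacobson R, j • r • x = 0 := by
  have : Nontrivial (R ∙ x) :=
    Submodule.nontrivial_iff_ne_bot.2 (Submodule.span_singleton_eq_bot.not.2 hx)
  obtain ⟨N, hN⟩ := IsAtomic.exists_atom (Submodule R (R ∙ x))
  have := isSimpleModule_iff_isAtom.2 hN
  obtain ⟨⟨s, hs⟩, hsN, hs0⟩ := N.exists_mem_ne_zero_of_ne_bot hN.1
  obtain ⟨r, rfl⟩ := Submodule.mem_span_singleton.1 hs
  refine ⟨r, fun h => hs0 (Subtype.ext h), fun j hj => ?_⟩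
  have hj' := IsSemisimpleModule.jacobson_le_annihilator R N hj
  exact congrArg (fun s : N => s.1.1) (Module.mem_annihilator.1 hj' ⟨_, hsN⟩)

variable {P : Type u} [AddCommGroup P] [Module R P] {f : P →ₗ[R] M}

theorem IsProjectiveCover.finite (hf : IsProjectiveCover f) [Module.Finite R M] :
    Module.Finite R P := by
  obtain ⟨k, g, hg⟩ := Module.Finite.exists_fin' R M
  obtain ⟨s, hs⟩ := Module.projective_lifting_property f g hf.surjective
  refine Module.Finite.of_surjective s (LinearMap.range_eq_top.1 (hf.superfluous _ ?_))
  refine eq_top_iff.2 fun p _ => ?_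
  obtain ⟨y, hy⟩ := hg (f p)
  refine Submodule.mem_sup.2 ⟨s y, ⟨y, rfl⟩, p - s y, ?_, add_sub_cancel _ _⟩
  rw [LinearMap.mem_ker, map_sub, ← hy, ← hs, LinearMap.comp_apply, sub_self]

theorem IsProjectiveCover.ker_le_jacobson (hf : IsProjectiveCover f) :
    LinearMap.ker f ≤ Module.jacobson R P := by
  refine le_sInf fun N hN => ?_
  by_contra hle
  exact hN.1 (hf.superfluous N (hN.2 _ (left_lt_sup.2 hle)))

end Radical

section Idempotents

variable {A : Type u} [Ring A] {f x : A}

theorem mem_leftIdeal (hf : IsIdempotentElem f) : x ∈ leftIdeal f ↔ x * f = x := by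
  rw [Submodule.mem_span_singleton]
  refine ⟨?_, fun h => ⟨x, h⟩⟩
  rintro ⟨a, rfl⟩
  rw [smul_eq_mul, mul_assoc, hf.eq]

theorem mem_rightIdeal (hf : IsIdempotentElem f) : x ∈ rightIdeal f ↔ f * x = x := by
  rw [Submodule.mem_span_singleton]
  refine ⟨?_, fun h => ⟨op x, h⟩⟩
  rintro ⟨a, rfl⟩
  rw [smul_eq_mul_unop, ← mul_assoc, hf.eq]

theorem IsUniserial.mem_or_mem {R M : Type u} [Ring R] [AddCommGroup M] [Module R M]
    {N : Submodule R M} (h : IsUniserial R N) {x y : M} (hx : x ∈ N) (hy : y ∈ N) :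
    x ∈ Submodule.span R {y} ∨ y ∈ Submodule.span R {x} := by
  have mem_span_of_le (u v : N) (huv : Submodule.span R {u} ≤ Submodule.span R {v}) :
      (u : M) ∈ Submodule.span R {(v : M)} := by
    obtain ⟨r, hr⟩ := Submodule.mem_span_singleton.1 (huv (Submodule.mem_span_singleton_self u))
    exact Submodule.mem_span_singleton.2 ⟨r, congrArg Subtype.val hr⟩
  exact (h _ _).imp (mem_span_of_le ⟨x, hx⟩ ⟨y, hy⟩) (mem_span_of_le ⟨y, hy⟩ ⟨x, hx⟩)

end Idempotents

section Structure

variable {K A : Type u} [Field K] [Ring A] [Algebra K A] {n : ℕ} [NeZero n] {e : ZMod n → A}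

namespace IsCNakayama

theorem isArtinianRing (hA : IsCNakayama K e) : IsArtinianRing A :=
  have := hA.finite
  isArtinian_of_tower K inferInstance

theorem isArtinianRing_op (hA : IsCNakayama K e) : IsArtinianRing Aᵐᵒᵖ :=
  have := hA.finite
  isArtinian_of_tower K inferInstance

theorem exists_sub_smul_mem_jacobson (hA : IsCNakayama K e) (a : A) (i : ZMod n) :
    ∃ c : K, a * e i - c • e i ∈ Ring.jacobson A ∧ e i * a - c • e i ∈ Ring.jacobson A := by
  obtain ⟨φ, hφ, hker⟩ := hA.elementary
  refine ⟨φ a i, ?_, ?_⟩ <;> rw [← hker, RingHom.mem_ker] <;> ext j <;>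
    by_cases h : j = i <;> simp [hφ, h]

theorem idem_mul_mul_mem_jacobson (hA : IsCNakayama K e) (a : A) {i j : ZMod n} (h : i ≠ j) :
    e i * a * e j ∈ Ring.jacobson A := by
  obtain ⟨φ, hφ, hker⟩ := hA.elementary
  rw [← hker, RingHom.mem_ker]
  ext k
  by_cases hk : k = i
  · subst hk
    simp [hφ, h]
  · simp [hφ, hk]

theorem exists_mul_eq_idem (hA : IsCNakayama K e) {v : A} {i : ZMod n} (hiv : e i * v = v)
    (hvi : v * e i = v) (hv : v ∉ Ring.jacobson A) : ∃ w, w * v = e i ∧ v * w = e i := by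
  obtain ⟨c, hc, -⟩ := hA.exists_sub_smul_mem_jacobson v i
  rw [hvi] at hc
  have hc0 : c ≠ 0 := by
    rintro rfl
    rw [zero_smul, sub_zero] at hc
    exact hv hc
  obtain ⟨w, hw⟩ := isUnit_one_add_of_mem_jacobson
    (Submodule.smul_of_tower_mem (Ring.jacobson A) c⁻¹ hc)
  rw [smul_sub, inv_smul_smul₀ hc0] at hw
  have hidem := (hA.idem.idem i).eq
  have hwi : (w : A) * e i = c⁻¹ • v := by
    rw [hw, add_mul, sub_mul, smul_mul_assoc, hvi, hidem, one_mul, add_sub_cancel]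
  have hiw : e i * (w : A) = c⁻¹ • v := by
    rw [hw, mul_add, mul_sub, mul_smul_comm, hiv, hidem, mul_one, add_sub_cancel]
  refine ⟨c⁻¹ • (↑w⁻¹ : A), ?_, ?_⟩
  · rw [smul_mul_assoc, ← mul_smul_comm, ← hwi, Units.inv_mul_cancel_left]
  · rw [mul_smul_comm, ← smul_mul_assoc, ← hiw, Units.mul_inv_cancel_right]

end IsCNakayama

end Structure

section Arrows

variable {K A : Type u} [Field K] [Ring A] [Algebra K A] {n : ℕ} [NeZero n] {e α : ZMod n → A}

/-- Elements `α j ∈ e j * J * e (j + 1)` outside `J ^ 2`, where `J` is the radical: they represent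
the arrows `j → j + 1` of the quiver. -/
structure IsArrows (e α : ZMod n → A) : Prop where
  mem (j : ZMod n) : α j ∈ Ring.jacobson A
  notMem_sq (j : ZMod n) : α j ∉ Ring.jacobson A * Ring.jacobson A
  idem_mul (j : ZMod n) : e j * α j = α j
  mul_idem (j : ZMod n) : α j * e (j + 1) = α j

theorem IsCNakayama.exists_isArrows (hA : IsCNakayama K e) : ∃ α, IsArrows e α := by
  have hidem (i : ZMod n) : e i * e i = e i := hA.idem.idem i
  have exists_notMem_sq (j : ZMod n) : ∃ x ∈ Ring.jacobson A,
      e j * (x * e (j + 1)) ∉ Ring.jacobson A * Ring.jacobson A := by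
    by_contra! h
    have hcount : arrowCount K (e j) (e (j + 1)) = 0 := by
      rw [arrowCount, LinearMap.le_ker_iff_map.1, finrank_bot]
      exact fun x hx => (Submodule.Quotient.mk_eq_zero _).2 (h x hx)
    rw [hA.quiver, if_pos rfl] at hcount
    exact one_ne_zero hcount
  choose x hx hx2 using exists_notMem_sq
  exact ⟨fun j => e j * (x j * e (j + 1)),
    fun j => Ideal.mul_mem_left _ _ (Ideal.mul_mem_right _ _ (hx j)), hx2,
    fun j => by rw [← mul_assoc, hidem], fun j => by rw [mul_assoc, mul_assoc, hidem]⟩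

namespace IsArrows

theorem mem_leftIdeal_of_idem_mul (hα : IsArrows e α) (hA : IsCNakayama K e) {y : A} {j k : ZMod n}
    (hy : y ∈ Ring.jacobson A) (hky : e k * y = y) (hyj : y * e (j + 1) = y) :
    y ∈ leftIdeal (α j) := by
  refine ((hA.left_uniserial (j + 1)).mem_or_mem ((mem_leftIdeal (hA.idem.idem _)).2 hyj)
    ((mem_leftIdeal (hA.idem.idem _)).2 (hα.mul_idem j))).elim id fun h => ?_
  obtain ⟨b, hb⟩ := Submodule.mem_span_singleton.1 h
  have hαy : e j * b * e k * y = α j := by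
    rw [mul_assoc _ (e k), hky, mul_assoc, ← hα.idem_mul j, ← hb, smul_eq_mul]
  have hv : e j * b * e k ∉ Ring.jacobson A := fun hv =>
    hα.notMem_sq j (hαy ▸ Ideal.mul_mem_mul hv hy)
  obtain rfl : j = k := by
    by_contra hjk
    exact hv (hA.idem_mul_mul_mem_jacobson b hjk)
  have hidem := (hA.idem.idem j).eq
  obtain ⟨w, hw, -⟩ := hA.exists_mul_eq_idem (by rw [← mul_assoc, ← mul_assoc, hidem])
    (by rw [mul_assoc, hidem]) hv
  exact Submodule.mem_span_singleton.2 ⟨w, by rw [← hαy, smul_eq_mul, ← mul_assoc, hw, hky]⟩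

theorem mem_rightIdeal_of_mul_idem (hα : IsArrows e α) (hA : IsCNakayama K e) {y : A}
    {j k : ZMod n} (hy : y ∈ Ring.jacobson A) (hjy : e j * y = y) (hyk : y * e k = y) :
    y ∈ rightIdeal (α j) := by
  refine ((hA.right_uniserial j).mem_or_mem ((mem_rightIdeal (hA.idem.idem _)).2 hjy)
    ((mem_rightIdeal (hA.idem.idem _)).2 (hα.idem_mul j))).elim id fun h => ?_
  obtain ⟨b, hb⟩ := Submodule.mem_span_singleton.1 h
  have hαy : y * (e k * b.unop * e (j + 1)) = α j := by
    rw [← mul_assoc, ← mul_assoc, hyk, ← hα.mul_idem j, ← hb, smul_eq_mul_unop]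
  have hv : e k * b.unop * e (j + 1) ∉ Ring.jacobson A := fun hv =>
    hα.notMem_sq j (hαy ▸ Ideal.mul_mem_mul hy hv)
  obtain rfl : k = j + 1 := by
    by_contra hjk
    exact hv (hA.idem_mul_mul_mem_jacobson b.unop hjk)
  have hidem := (hA.idem.idem (j + 1)).eq
  obtain ⟨w, -, hw⟩ := hA.exists_mul_eq_idem (by rw [← mul_assoc, ← mul_assoc, hidem])
    (by rw [mul_assoc, hidem]) hv
  exact Submodule.mem_span_singleton.2
    ⟨op w, by rw [← hαy, op_smul_eq_mul, mul_assoc, hw, hyk]⟩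

theorem exists_mul_idem_eq (hα : IsArrows e α) (hA : IsCNakayama K e) {y : A} (j : ZMod n)
    (hy : y ∈ Ring.jacobson A) : ∃ a, y * e (j + 1) = a * α j := by
  have hmem : ∑ k, e k * (y * e (j + 1)) ∈ leftIdeal (α j) := sum_mem fun k _ =>
    hα.mem_leftIdeal_of_idem_mul hA (Ideal.mul_mem_left _ _ (Ideal.mul_mem_right _ _ hy))
      (by rw [← mul_assoc, (hA.idem.idem k).eq])
      (by rw [mul_assoc, mul_assoc, (hA.idem.idem (j + 1)).eq])
  rw [← Finset.sum_mul, hA.idem.complete, one_mul] at hmem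
  obtain ⟨a, ha⟩ := Submodule.mem_span_singleton.1 hmem
  exact ⟨a, ha.symm⟩

theorem exists_idem_mul_eq (hα : IsArrows e α) (hA : IsCNakayama K e) {y : A} (j : ZMod n)
    (hy : y ∈ Ring.jacobson A) : ∃ a, e j * y = α j * a := by
  have hmem : ∑ k, e j * y * e k ∈ rightIdeal (α j) := sum_mem fun k _ =>
    hα.mem_rightIdeal_of_mul_idem hA (Ideal.mul_mem_right _ _ (Ideal.mul_mem_left _ _ hy))
      (by rw [← mul_assoc, ← mul_assoc, (hA.idem.idem j).eq])
      (by rw [mul_assoc, (hA.idem.idem k).eq])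
  rw [← Finset.mul_sum, hA.idem.complete, mul_one] at hmem
  obtain ⟨a, ha⟩ := Submodule.mem_span_singleton.1 hmem
  exact ⟨a.unop, ha.symm⟩

end IsArrows

end Arrows

section Duality

variable {K A : Type u} [Field K] [Ring A] [Algebra K A]

section CoinducedMaps

variable {X : Type u} [AddCommGroup X] [Module K X] [Module Aᵐᵒᵖ X] [IsScalarTower K Aᵐᵒᵖ X]

/-- The map `X → D(L)`, `x ↦ (y ↦ l (x * y))`, of right `A`-modules which a functional `l` on `X`
induces for a left ideal `L`. -/
noncomputable def toKDual (L : Submodule A A) (l : X →ₗ[K] K) : X →ₗ[Aᵐᵒᵖ] KDual K L where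
  toFun x :=
    { toFun := fun y => l (op (y : A) • x)
      map_add' := fun y z => by
        rw [Submodule.coe_add, op_add, add_smul, map_add]
      map_smul' := fun c y => by
        rw [Submodule.coe_smul_of_tower, op_smul, smul_assoc, map_smul, RingHom.id_apply] }
  map_add' x y := LinearMap.ext fun z => (congrArg l (smul_add (op z.1) x y)).trans (map_add l _ _)
  map_smul' a x := LinearMap.ext fun z => congrArg l (mul_smul (op z.1) a x).symm

/-- The functional `x ↦ g x y` on `X` given by a map `g : X → D(M)` of right `A`-modules and
`y : M`. -/
noncomputable def evalKDual {M : Type u} [AddCommGroup M] [Module K M] [Module A M]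
    [IsScalarTower K A M] (g : X →ₗ[Aᵐᵒᵖ] KDual K M) (y : M) : X →ₗ[K] K where
  toFun x := (show M →ₗ[K] K from g x) y
  map_add' x x' := LinearMap.congr_fun (map_add g x x') y
  map_smul' c x := by
    have h := LinearMap.congr_fun (map_smul g (algebraMap K Aᵐᵒᵖ c) x) y
    rw [algebraMap_smul] at h
    refine h.trans ((congrArg (show M →ₗ[K] K from g x) (algebraMap_smul A c y)).trans ?_)
    exact map_smul (show M →ₗ[K] K from g x) c y

end CoinducedMaps

theorem injective_kDual_leftIdeal {f : A} (hf : IsIdempotentElem f) :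
    Module.Injective Aᵐᵒᵖ (KDual K (leftIdeal f)) := by
  refine Module.Baer.injective fun I g => ?_
  let f' : leftIdeal f := ⟨f, Submodule.mem_span_singleton_self f⟩
  obtain ⟨r, hr⟩ := LinearMap.exists_leftInverse_of_injective
    (I.subtype.restrictScalars K) (LinearMap.ker_eq_bot.2 I.subtype_injective)
  refine ⟨toKDual _ (evalKDual g f' ∘ₗ r), fun x hx => LinearMap.ext fun y => ?_⟩
  have hy : y.1 • f' = y := Subtype.ext ((mem_leftIdeal hf).1 y.2)
  have hgy := LinearMap.congr_fun (map_smul g (op y.1) ⟨x, hx⟩) f'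
  refine (congrArg (evalKDual g f') (LinearMap.congr_fun hr (op y.1 • ⟨x, hx⟩))).trans
    (hgy.trans ?_)
  exact congrArg (show leftIdeal f →ₗ[K] K from g ⟨x, hx⟩) hy

theorem exists_toKDual_ne_zero {X : Type u} [AddCommGroup X] [Module Aᵐᵒᵖ X] {a : A} {x : X}
    (hx : op a • x ≠ 0) : ∃ g : X →ₗ[Aᵐᵒᵖ] KDual K (leftIdeal a), g x ≠ 0 := by
  let _ : Module K X := Module.compHom X (algebraMap K Aᵐᵒᵖ)
  have : IsScalarTower K Aᵐᵒᵖ X := IsScalarTower.of_algebraMap_smul fun _ _ => rfl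
  obtain ⟨l, hl⟩ := Module.Projective.exists_dual_ne_zero K hx
  exact ⟨toKDual _ l, fun h =>
    hl (LinearMap.congr_fun h ⟨a, Submodule.mem_span_singleton_self a⟩)⟩

end Duality

section SoclePairing

variable {K A : Type u} [Field K] [Ring A] [Algebra K A] {n : ℕ} [NeZero n] {e : ZMod n → A}

namespace IsCNakayama

variable {w j : ZMod n} {t y : A}

theorem mem_rightIdeal_of_mul_jacobson_eq_zero (hA : IsCNakayama K e) (hwt : e w * t = t)
    (htj : t * e j = t) (ht : ∀ x ∈ Ring.jacobson A, t * x = 0) (hwy : e w * y = y)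
    (hy0 : y ≠ 0) : t ∈ rightIdeal y := by
  refine ((hA.right_uniserial w).mem_or_mem ((mem_rightIdeal (hA.idem.idem _)).2 hwt)
    ((mem_rightIdeal (hA.idem.idem _)).2 hwy)).elim id fun h => ?_
  obtain ⟨b, rfl⟩ := Submodule.mem_span_singleton.1 h
  obtain ⟨c, -, hc⟩ := hA.exists_sub_smul_mem_jacobson b.unop j
  have htb : b • t = c • t := by
    simpa only [smul_eq_mul_unop, mul_sub, ← mul_assoc, htj, mul_smul_comm, sub_eq_zero]
      using ht _ hc
  rw [htb] at hy0 ⊢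
  have hc0 : c ≠ 0 := left_ne_zero_of_smul hy0
  refine Submodule.mem_span_singleton.2 ⟨algebraMap K _ c⁻¹, ?_⟩
  rw [algebraMap_smul, inv_smul_smul₀ hc0]

theorem mem_leftIdeal_of_jacobson_mul_eq_zero (hA : IsCNakayama K e) (hwt : e w * t = t)
    (htj : t * e j = t) (ht : ∀ x ∈ Ring.jacobson A, x * t = 0) (hyj : y * e j = y)
    (hy0 : y ≠ 0) : t ∈ leftIdeal y := by
  refine ((hA.left_uniserial j).mem_or_mem ((mem_leftIdeal (hA.idem.idem _)).2 htj)
    ((mem_leftIdeal (hA.idem.idem _)).2 hyj)).elim id fun h => ?_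
  obtain ⟨b, rfl⟩ := Submodule.mem_span_singleton.1 h
  obtain ⟨c, hc, -⟩ := hA.exists_sub_smul_mem_jacobson b w
  have hbt : b • t = c • t := by
    simpa only [smul_eq_mul, sub_mul, mul_assoc, hwt, smul_mul_assoc, sub_eq_zero] using ht _ hc
  rw [hbt] at hy0 ⊢
  have hc0 : c ≠ 0 := left_ne_zero_of_smul hy0
  refine Submodule.mem_span_singleton.2 ⟨algebraMap K _ c⁻¹, ?_⟩
  rw [algebraMap_smul, inv_smul_smul₀ hc0]

/-- An element `t` in the socle of `e w A` and of `A e j` makes `(x, y) ↦ l (x * y)` a perfect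
pairing of these two modules, for any functional `l` with `l t ≠ 0`. -/
theorem nonempty_equiv_kDual (hA : IsCNakayama K e) (ht0 : t ≠ 0) (hwt : e w * t = t)
    (htj : t * e j = t) (hJt : ∀ x ∈ Ring.jacobson A, x * t = 0)
    (htJ : ∀ x ∈ Ring.jacobson A, t * x = 0) :
    Nonempty (rightIdeal (e w) ≃ₗ[Aᵐᵒᵖ] KDual K (leftIdeal (e j))) := by
  have := hA.finite
  have hw : e w * e w = e w := hA.idem.idem w
  have hj : e j * e j = e j := hA.idem.idem j
  obtain ⟨l, hl⟩ := Module.Projective.exists_dual_ne_zero K ht0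
  let B : rightIdeal (e w) →ₗ[K] leftIdeal (e j) →ₗ[K] K := ((LinearMap.mul K A).compr₂ l).compl₁₂
    ((rightIdeal (e w)).subtype.restrictScalars K) ((leftIdeal (e j)).subtype.restrictScalars K)
  have left_nondegenerate : Function.Injective B := by
    refine (injective_iff_map_eq_zero B).2 fun x hx => ?_
    by_contra hx0
    obtain ⟨b, hb⟩ := Submodule.mem_span_singleton.1 <| hA.mem_rightIdeal_of_mul_jacobson_eq_zero
      hwt htj htJ ((mem_rightIdeal hw).1 x.2) (Subtype.coe_ne_coe.2 hx0)
    have hb' := LinearMap.congr_fun hx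
      ⟨b.unop * e j, (mem_leftIdeal hj).2 (by rw [mul_assoc, hj])⟩
    refine hl ?_
    rw [← htj, ← hb, smul_eq_mul_unop, mul_assoc]
    exact hb'
  have right_nondegenerate : Function.Injective B.flip := by
    refine (injective_iff_map_eq_zero B.flip).2 fun y hy => ?_
    by_contra hy0
    obtain ⟨b, hb⟩ := Submodule.mem_span_singleton.1 <| hA.mem_leftIdeal_of_jacobson_mul_eq_zero
      hwt htj hJt ((mem_leftIdeal hj).1 y.2) (Subtype.coe_ne_coe.2 hy0)
    have hb' := LinearMap.congr_fun hy
      ⟨e w * b, (mem_rightIdeal hw).2 (by rw [← mul_assoc, hw])⟩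
    refine hl ?_
    rw [← hwt, ← hb, smul_eq_mul, ← mul_assoc]
    exact hb'
  have : FiniteDimensional K (rightIdeal (e w)) :=
    Module.Finite.of_injective ((rightIdeal (e w)).subtype.restrictScalars K)
      Subtype.val_injective
  have hB := LinearMap.IsPerfPair.of_injective left_nondegenerate right_nondegenerate
  exact ⟨LinearEquiv.ofBijective
    (toKDual (leftIdeal (e j)) (l ∘ₗ (rightIdeal (e w)).subtype.restrictScalars K))
    hB.bijective_left⟩

end IsCNakayama

end SoclePairing

section Idempotents

variable {A : Type u} [Ring A]

theorem exists_smul_ne_zero_of_sum_eq_one {R M ι : Type*} [Ring R] [AddCommGroup M] [Module R M]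
    [Fintype ι] {e : ι → R} (he : ∑ i, e i = 1) {x : M} (hx : x ≠ 0) : ∃ i, e i • x ≠ 0 := by
  by_contra! h
  rw [← one_smul R x, ← he, Finset.sum_smul] at hx
  exact hx (Finset.sum_eq_zero fun i _ => h i)

/-- Left multiplication by `f`, as a map of right modules from `A` to `f A`. -/
def toRightIdeal (f : A) : A →ₗ[Aᵐᵒᵖ] rightIdeal f where
  toFun x := ⟨f * x, Submodule.mem_span_singleton.2 ⟨op x, rfl⟩⟩
  map_add' x y := Subtype.ext (mul_add f x y)
  map_smul' a x := Subtype.ext (mul_assoc f x a.unop).symm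

theorem projective_rightIdeal {f : A} (hf : IsIdempotentElem f) :
    Module.Projective Aᵐᵒᵖ (rightIdeal f) :=
  Module.Projective.of_split (rightIdeal f).subtype (toRightIdeal f)
    (LinearMap.ext fun x => Subtype.ext ((mem_rightIdeal hf).1 x.2))

end Idempotents

section SocleVertices

variable {A : Type u} [Ring A] {n : ℕ}

/-- The simple module at the vertex `j` embeds in the right module `M`: some `s : M` which is
killed by the radical of `A` is not killed by `e j`. -/
def IsSocleVertex (e : ZMod n → A) (M : Type u) [AddCommGroup M] [Module Aᵐᵒᵖ M] (j : ZMod n) :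
    Prop :=
  ∃ s : M, op (e j) • s ≠ 0 ∧ ∀ x ∈ Ring.jacobson A, op x • s = 0

variable {e : ZMod n → A} {X Y : Type u} [AddCommGroup X] [Module Aᵐᵒᵖ X] [AddCommGroup Y]
  [Module Aᵐᵒᵖ Y] {j : ZMod n}

theorem IsSocleVertex.of_isCogenerated (hj : IsSocleVertex e X j) (h : IsCogenerated Aᵐᵒᵖ Y X) :
    IsSocleVertex e Y j := by
  obtain ⟨s, hs, hsJ⟩ := hj
  obtain ⟨f, hf⟩ := h _ hs
  exact ⟨f s, by rwa [← map_smul], fun x hx => by rw [← map_smul, hsJ x hx, map_zero]⟩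

variable {K : Type u} [Field K] [Algebra K A] [NeZero n]

theorem IsArrows.isSocleVertex {α : ZMod n → A} (hα : IsArrows e α) (hA : IsCNakayama K e) {p : X}
    (hp : op (α j) • p = 0) (hj : op (e j) • p ≠ 0) : IsSocleVertex e X j := by
  refine ⟨op (e j) • p, ?_, fun x hx => ?_⟩
  · rwa [← mul_smul, ← op_mul, (hA.idem.idem j).eq]
  · obtain ⟨a, ha⟩ := hα.exists_idem_mul_eq hA j hx
    rw [← mul_smul, ← op_mul, ha, op_mul, mul_smul, hp, smul_zero]

namespace IsCNakayama

theorem sum_op_idem (hA : IsCNakayama K e) : ∑ j, op (e j) = 1 := by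
  rw [← Finset.op_sum, hA.idem.complete, op_one]

theorem exists_isSocleVertex_of_ne_zero (hA : IsCNakayama K e) {x : X} (hx : x ≠ 0) :
    ∃ (j : ZMod n) (a : Aᵐᵒᵖ), op (e j) • a • x ≠ 0 ∧ ∀ y ∈ Ring.jacobson A, op y • a • x = 0 := by
  have := hA.isArtinianRing_op
  obtain ⟨a, ha, haJ⟩ := exists_smul_ne_zero_jacobson_smul_eq_zero (R := Aᵐᵒᵖ) hx
  obtain ⟨j, hj⟩ := exists_smul_ne_zero_of_sum_eq_one hA.sum_op_idem ha
  exact ⟨j, a, hj, fun y hy => haJ _ (op_mem_jacobson.2 hy)⟩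

theorem exists_equiv_kDual_of_isSocleVertex (hA : IsCNakayama K e) (hj : IsSocleVertex e A j) :
    ∃ w, Nonempty (rightIdeal (e w) ≃ₗ[Aᵐᵒᵖ] KDual K (leftIdeal (e j))) := by
  have := hA.isArtinianRing
  obtain ⟨s, hs, hsJ⟩ := hj
  obtain ⟨u, hu, huJ⟩ := exists_smul_ne_zero_jacobson_smul_eq_zero (R := A) hs
  obtain ⟨w, hw⟩ := exists_smul_ne_zero_of_sum_eq_one hA.idem.complete hu
  simp only [smul_eq_mul, op_smul_eq_mul] at hu huJ hw hsJ
  refine ⟨w, hA.nonempty_equiv_kDual hw ?_ ?_ (fun x hx => ?_) fun x hx => ?_⟩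
  · rw [← mul_assoc, (hA.idem.idem w).eq]
  · simp only [mul_assoc, (hA.idem.idem j).eq]
  · rw [← mul_assoc]
    exact huJ _ (Ideal.mul_mem_right _ _ hx)
  · rw [mul_assoc, mul_assoc, mul_assoc, hsJ _ (Ideal.mul_mem_left _ _ hx), mul_zero, mul_zero]

theorem projective_kDual_of_isSocleVertex (hA : IsCNakayama K e) (hj : IsSocleVertex e A j) :
    Module.Projective Aᵐᵒᵖ (KDual K (leftIdeal (e j))) := by
  obtain ⟨w, ⟨f⟩⟩ := hA.exists_equiv_kDual_of_isSocleVertex hj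
  have := projective_rightIdeal (hA.idem.idem w)
  exact Module.Projective.of_equiv f

theorem finite_kDual_of_isSocleVertex (hA : IsCNakayama K e) (hj : IsSocleVertex e A j) :
    Module.Finite Aᵐᵒᵖ (KDual K (leftIdeal (e j))) := by
  obtain ⟨w, ⟨f⟩⟩ := hA.exists_equiv_kDual_of_isSocleVertex hj
  exact Module.Finite.equiv f

end IsCNakayama

end SocleVertices

section ProjectiveInjective

variable {K A : Type u} [Field K] [Ring A] [Algebra K A] {n : ℕ} [NeZero n] {e : ZMod n → A}

/-- The direct sum of the modules `D(A e_j)` over the socle vertices `j` of `A`, which are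
the projective ones among the indecomposable injective modules. -/
abbrev ProjInj (K : Type u) {A : Type u} [Field K] [Ring A] [Algebra K A] {n : ℕ}
    (e : ZMod n → A) : Type u :=
  ∀ j : {j // IsSocleVertex e A j}, KDual K (leftIdeal (e j.1))

namespace IsCNakayama

theorem projective_projInj (hA : IsCNakayama K e) : Module.Projective Aᵐᵒᵖ (ProjInj K e) :=
  have := fun j : {j // IsSocleVertex e A j} => hA.projective_kDual_of_isSocleVertex j.2
  projective_pi _

theorem finite_projInj (hA : IsCNakayama K e) : Module.Finite Aᵐᵒᵖ (ProjInj K e) :=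
  have := fun j : {j // IsSocleVertex e A j} => hA.finite_kDual_of_isSocleVertex j.2
  inferInstance

theorem injective_projInj (hA : IsCNakayama K e) : Module.Injective Aᵐᵒᵖ (ProjInj K e) :=
  have := fun j : {j // IsSocleVertex e A j} =>
    injective_kDual_leftIdeal (K := K) (hA.idem.idem j.1)
  Module.Injective.pi _ _

theorem isCogenerated_projInj (hA : IsCNakayama K e) {X : Type u} [AddCommGroup X] [Module Aᵐᵒᵖ X]
    (hX : ∀ j, IsSocleVertex e X j → IsSocleVertex e A j) :
    IsCogenerated Aᵐᵒᵖ (ProjInj K e) X := by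
  intro x hx
  obtain ⟨j, a, hj, haJ⟩ := hA.exists_isSocleVertex_of_ne_zero hx
  obtain ⟨g, hg⟩ := exists_toKDual_ne_zero (K := K) hj
  let D (k : {j // IsSocleVertex e A j}) := KDual K (leftIdeal (e k.1))
  let i : {j // IsSocleVertex e A j} := ⟨j, hX j ⟨a • x, hj, haJ⟩⟩
  refine ⟨LinearMap.single Aᵐᵒᵖ D i ∘ₗ g, fun h => hg ?_⟩
  have hgx : g x = 0 := by
    have hi := congrFun h i
    rwa [LinearMap.comp_apply, LinearMap.single_apply, Pi.single_eq_same] at hi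
  rw [map_smul, hgx, smul_zero]

end IsCNakayama

end ProjectiveInjective

section Balanced

theorem subsingleton_of_surjective_of_projective {R M P : Type*} [Ring R] [AddCommGroup M]
    [Module R M] [AddCommGroup P] [Module R P] [Module.Projective R P]
    (hM : ∀ N N' : Submodule R M, IsCompl N N' → Module.Projective R N → N = ⊥)
    {f : M →ₗ[R] P} (hf : Function.Surjective f) : Subsingleton P := by
  obtain ⟨σ, hσ⟩ := Module.projective_lifting_property f LinearMap.id hf
  have hfσ : ∀ p, f (σ p) = p := LinearMap.congr_fun hσ
  have hcompl : IsCompl (LinearMap.range σ) (LinearMap.ker (σ.rangeRestrict ∘ₗ f)) :=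
    LinearMap.isCompl_of_proj <| by
      rintro ⟨_, p, rfl⟩
      exact Subtype.ext (congrArg σ (hfσ p))
  have hinj : Function.Injective σ := Function.LeftInverse.injective hfσ
  have hσ0 : σ = 0 := LinearMap.range_eq_bot.1 <|
    hM _ _ hcompl (Module.Projective.of_equiv (LinearEquiv.ofInjective σ hinj))
  exact subsingleton_of_forall_eq 0 fun p => by rw [← hfσ p, hσ0, LinearMap.zero_apply, map_zero]

variable {A : Type u} [Ring A] {n : ℕ}

/-- The simple module at a vertex `j + 1` is a direct summand of the top of `X` only if the simple
module at `j` embeds in `A`. This is the condition on a torsionless module under which the second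
term of its minimal injective resolution is projective as well. -/
def IsBalanced (e : ZMod n → A) (X : Type u) [AddCommGroup X] [Module Aᵐᵒᵖ X] : Prop :=
  ∀ j, ¬ IsSocleVertex e A j → ∀ x : X, op (e (j + 1)) • x ∈ Module.jacobson Aᵐᵒᵖ X

variable {e α : ZMod n → A} {X Y : Type u} [AddCommGroup X] [Module Aᵐᵒᵖ X] [AddCommGroup Y]
  [Module Aᵐᵒᵖ Y]

theorem isBalanced_pi {m : ℕ} {X : Fin m → Type u} [∀ k, AddCommGroup (X k)]
    [∀ k, Module Aᵐᵒᵖ (X k)] (h : ∀ k, IsBalanced e (X k)) : IsBalanced e (∀ k, X k) := by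
  intro j hj x
  rw [← LinearMap.sum_single_apply _ x, Finset.smul_sum]
  refine sum_mem fun k _ => ?_
  rw [← Pi.single_smul]
  exact Module.le_comap_jacobson (LinearMap.single Aᵐᵒᵖ X k) (h k j hj (x k))

theorem IsBalanced.of_equiv (hX : IsBalanced e X) (f : X ≃ₗ[Aᵐᵒᵖ] Y) : IsBalanced e Y := by
  intro j hj y
  rw [← f.apply_symm_apply y, ← map_smul]
  exact Module.le_comap_jacobson f.toLinearMap (hX j hj (f.symm y))

theorem IsBalanced.of_isProjectiveCover (hX : IsBalanced e X) {f : Y →ₗ[Aᵐᵒᵖ] X}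
    (hf : IsProjectiveCover f) : IsBalanced e Y := by
  intro j hj y
  rw [← Module.comap_jacobson_of_ker_le hf.surjective hf.ker_le_jacobson, Submodule.mem_comap,
    map_smul]
  exact hX j hj (f y)

variable {K : Type u} [Field K] [Algebra K A] [NeZero n]

theorem IsArrows.exists_op_idem_smul_eq (hα : IsArrows e α) (hA : IsCNakayama K e) (j : ZMod n)
    {x : X} (hx : x ∈ Module.jacobson Aᵐᵒᵖ X) : ∃ q, op (e (j + 1)) • x = op (α j) • q := by
  have := hA.isArtinianRing_op
  rw [jacobson_eq_jacobson_smul_top] at hx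
  refine Submodule.smul_induction_on hx (fun r hr y _ => ?_) ?_
  · obtain ⟨a, ha⟩ := hα.exists_mul_idem_eq hA j (y := r.unop) (op_mem_jacobson.1 hr)
    have hr' : op (e (j + 1)) * r = op (α j) * op a := unop_injective ha
    exact ⟨op a • y, by rw [← mul_smul, hr', mul_smul]⟩
  · rintro x y ⟨p, hp⟩ ⟨q, hq⟩
    exact ⟨p + q, by rw [smul_add, smul_add, hp, hq]⟩

theorem IsCNakayama.apply_mem_jacobson (hA : IsCNakayama K e)
    (hX : ∀ N N' : Submodule Aᵐᵒᵖ X, IsCompl N N' → Module.Projective Aᵐᵒᵖ N → N = ⊥)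
    (h : X →ₗ[Aᵐᵒᵖ] A) (x : X) : h x ∈ Ring.jacobson A := by
  suffices ∀ i k, e i * h x * e k ∈ Ring.jacobson A by
    rw [← one_mul (h x), ← mul_one (1 * h x), ← hA.idem.complete, Finset.sum_mul, Finset.sum_mul]
    simp only [Finset.mul_sum]
    exact sum_mem fun i _ => sum_mem fun k _ => this i k
  intro i k
  obtain hik | rfl := ne_or_eq i k
  · exact hA.idem_mul_mul_mem_jacobson _ hik
  by_contra hv
  have hidem : e i * e i = e i := hA.idem.idem i
  obtain ⟨w, -, hw⟩ := hA.exists_mul_eq_idem (by rw [← mul_assoc, ← mul_assoc, hidem])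
    (by rw [mul_assoc, hidem]) hv
  have hsurj : Function.Surjective (toRightIdeal (e i) ∘ₗ h) := by
    refine fun y => ⟨op (e i * w * y) • x, Subtype.ext ?_⟩
    calc e i * h (op (e i * w * y) • x) = e i * h x * e i * w * y := by
          rw [map_smul, op_smul_eq_mul]
          simp only [mul_assoc]
      _ = y := by rw [hw, (mem_rightIdeal hidem).1 y.2]
  have := projective_rightIdeal hidem
  have := subsingleton_of_surjective_of_projective hX hsurj
  have hi : e i = 0 := congrArg Subtype.val
    (Subsingleton.elim (⟨e i, Submodule.mem_span_singleton_self _⟩ : rightIdeal (e i)) 0)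
  rw [hi, mul_zero] at hv
  exact hv (zero_mem _)

/-- For a reflexive module `X`, the elements of `X * e (j + 1)` divisible by `α j` are those which
all maps `X → A` send into `A * α j`, as right multiplication by `α j` is injective on `A * e j` if
the simple module at `j` does not embed in `A`. -/
theorem IsReflexive.isBalanced (hX : IsReflexive A X) (hA : IsCNakayama K e)
    (hXJ : ∀ (h : X →ₗ[Aᵐᵒᵖ] A) x, h x ∈ Ring.jacobson A) : IsBalanced e X := by
  obtain ⟨α, hα⟩ := hA.exists_isArrows
  intro j hj x
  let mulArrow : leftIdeal (e j) →ₗ[A] A :=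
    LinearMap.toSpanSingleton A A (α j) ∘ₗ (leftIdeal (e j)).subtype
  have mulArrow_injective : Function.Injective mulArrow := by
    refine (injective_iff_map_eq_zero _).2 fun a ha => ?_
    by_contra ha0
    refine hj (hα.isSocleVertex hA (p := a.1) ha ?_)
    rwa [op_smul_eq_mul, (mem_leftIdeal (hA.idem.idem j)).1 a.2, ne_eq, Submodule.coe_eq_zero]
  let ev : (X →ₗ[Aᵐᵒᵖ] A) →ₗ[A] A := LinearMap.applyₗ' A (op (e (j + 1)) • x)
  have ev_mem (h) : ev h ∈ LinearMap.range mulArrow := by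
    obtain ⟨a, ha⟩ := hα.exists_mul_idem_eq hA j (hXJ h x)
    refine ⟨⟨a * e j, Submodule.mem_span_singleton.2 ⟨a, rfl⟩⟩, ?_⟩
    calc a * e j * α j = h x * e (j + 1) := by rw [mul_assoc, hα.idem_mul, ha]
      _ = ev h := (map_smul h _ _).symm
  let mulArrowEquiv := LinearEquiv.ofInjective mulArrow mulArrow_injective
  let quotient := mulArrowEquiv.symm.toLinearMap ∘ₗ ev.codRestrict _ ev_mem
  obtain ⟨q, hq⟩ := hX.surjective ((leftIdeal (e j)).subtype ∘ₗ quotient)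
  have hxq : op (e (j + 1)) • x = op (α j) • q := by
    refine hX.injective (LinearMap.ext fun h => ?_)
    calc ev h = quotient h * α j :=
          congrArg Subtype.val (mulArrowEquiv.apply_symm_apply ⟨ev h, ev_mem h⟩).symm
      _ = h q * α j := congrArg (· * α j) (LinearMap.congr_fun hq h).symm
      _ = h (op (α j) • q) := (map_smul h _ _).symm
  rw [hxq]
  exact op_smul_mem_jacobson (hα.mem j) q

end Balanced

section DominantDimension

variable {K A : Type u} [Field K] [Ring A] [Algebra K A] {n : ℕ} [NeZero n] {e : ZMod n → A}
  {X : Type u} [AddCommGroup X] [Module Aᵐᵒᵖ X]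

namespace IsCNakayama

variable (hA : IsCNakayama K e)
include hA

theorem isArtinian_of_finite [Module.Finite Aᵐᵒᵖ X] : IsArtinian Aᵐᵒᵖ X :=
  have := hA.isArtinianRing_op
  inferInstance

theorem projective_hull [Module.Finite Aᵐᵒᵖ X]
    (hX : ∀ j, IsSocleVertex e X j → IsSocleVertex e A j) :
    Module.Projective Aᵐᵒᵖ (hull Aᵐᵒᵖ X) :=
  have := hA.isArtinian_of_finite (X := X)
  have := hA.injective_projInj
  have := hA.projective_projInj
  (hA.isCogenerated_projInj hX).projective_hull

theorem finite_hull [Module.Finite Aᵐᵒᵖ X]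
    (hX : ∀ j, IsSocleVertex e X j → IsSocleVertex e A j) :
    Module.Finite Aᵐᵒᵖ (hull Aᵐᵒᵖ X) :=
  have := hA.isArtinian_of_finite (X := X)
  have := hA.injective_projInj
  have := hA.finite_projInj
  (hA.isCogenerated_projInj hX).finite_hull

theorem isSocleVertex_of_isSocleVertex_quotient {E : Type u} [AddCommGroup E] [Module Aᵐᵒᵖ E]
    (hE : IsCogenerated Aᵐᵒᵖ A E) (hX : IsBalanced e X) {ι : X →ₗ[Aᵐᵒᵖ] E} {j : ZMod n}
    (hj : IsSocleVertex e (E ⧸ LinearMap.range ι) j) : IsSocleVertex e A j := by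
  by_contra hjA
  obtain ⟨α, hα⟩ := hA.exists_isArrows
  obtain ⟨s, hs, hsJ⟩ := hj
  obtain ⟨c, rfl⟩ := Submodule.mkQ_surjective _ s
  obtain ⟨x, hx⟩ : op (α j) • c ∈ LinearMap.range ι :=
    (Submodule.Quotient.mk_eq_zero _).1 (hsJ _ (hα.mem j))
  obtain ⟨q, hq⟩ := hα.exists_op_idem_smul_eq hA j (hX j hjA x)
  have hdiff : op (α j) • (c - ι q) = 0 := by
    rw [smul_sub, sub_eq_zero, ← map_smul, ← hq, map_smul, map_smul, hx]
    simp only [← mul_smul, ← op_mul, hα.mul_idem]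
  have hcq : op (e j) • (c - ι q) = 0 := by
    by_contra h
    exact hjA ((hα.isSocleVertex hA hdiff h).of_isCogenerated hE)
  rw [smul_sub, sub_eq_zero, ← map_smul] at hcq
  exact hs ((Submodule.Quotient.mk_eq_zero _).2 ⟨_, hcq.symm⟩)

theorem two_le_domDim [Module.Finite Aᵐᵒᵖ X] (hX : IsCogenerated Aᵐᵒᵖ A X)
    (hbal : IsBalanced e X) : 2 ≤ domDim Aᵐᵒᵖ X := by
  have hsoc : ∀ j, IsSocleVertex e X j → IsSocleVertex e A j := fun _ hj => hj.of_isCogenerated hX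
  have hproj := hA.projective_hull hsoc
  have := hA.finite_hull hsoc
  exact Nak.two_le_domDim X hproj <| hA.projective_hull fun _ hj =>
    hA.isSocleVertex_of_isSocleVertex_quotient (isCogenerated_of_projective _) hbal hj

end IsCNakayama

theorem InRGp.isBalanced (hA : IsCNakayama K e) (hX : InRGp A X) : IsBalanced e X :=
  hX.1.isReflexive.isBalanced hA (hA.apply_mem_jacobson hX.2)

theorem InRGp.two_le_domDim (hA : IsCNakayama K e) (hX : InRGp A X) : 2 ≤ domDim Aᵐᵒᵖ X :=
  have := hX.1.1
  hA.two_le_domDim hX.1.isReflexive.isCogenerated (hX.isBalanced hA)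

theorem IsIndecNonprojGp.inRGp (hX : IsIndecNonprojGp A X) : InRGp A X := by
  refine ⟨hX.2.2, fun N N' hN hproj => (hX.1.2 N N' hN).resolve_right fun h => hX.2.1 ?_⟩
  rw [h] at hN
  rw [eq_top_of_isCompl_bot hN] at hproj
  exact Module.Projective.of_equiv Submodule.topEquiv

theorem InGorensteinCore.two_le_domDim (hA : IsCNakayama K e) (hX : InGorensteinCore A X) :
    2 ≤ domDim Aᵐᵒᵖ X := by
  obtain ⟨m, Y, hY, ⟨f⟩⟩ := hX
  have hsummand : ∀ k, Module.Finite Aᵐᵒᵖ (Y k) ∧ IsCogenerated Aᵐᵒᵖ A (Y k) ∧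
      IsBalanced e (Y k) := by
    intro k
    obtain h | ⟨G, g, hG, hg⟩ := hY k
    · exact ⟨h.2.2.1, h.2.2.isReflexive.isCogenerated, h.inRGp.isBalanced hA⟩
    · have := hG.2.2.1
      have := hg.projective
      exact ⟨hg.finite, isCogenerated_of_projective _,
        (hG.inRGp.isBalanced hA).of_isProjectiveCover hg⟩
  have := fun k => (hsummand k).1
  have : Module.Finite Aᵐᵒᵖ X := Module.Finite.equiv f.symm
  exact hA.two_le_domDim ((isCogenerated_pi fun k => (hsummand k).2.1).of_injective f.injective)
    ((isBalanced_pi fun k => (hsummand k).2.2).of_equiv f.symm)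

theorem IsCNakayama.isGorensteinDominant (hA : IsCNakayama K e) : IsGorensteinDominant A :=
  ⟨one_le_domDim A (hA.projective_hull fun _ => id), fun _ _ _ hM => hM.two_le_domDim hA⟩

end DominantDimension

section ResolutionQuiver

theorem jacobson_smul_socle_eq_zero {R M : Type u} [Ring R] [AddCommGroup M] [Module R M] {x : R}
    (hx : x ∈ Ring.jacobson R) (s : socle R M) : x • s = 0 := by
  have : IsSemisimpleModule R (socle R M) := by
    rw [socle, sSup_eq_iSup]
    refine isSemisimpleModule_biSup_of_isSemisimpleModule_submodule fun N hN => ?_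
    have : IsSimpleModule R N := hN
    infer_instance
  exact Module.mem_annihilator.1 (IsSemisimpleModule.jacobson_le_annihilator R _ hx) s

theorem apply_mem_jacobson_of_mem_jacobson {A X : Type u} [Ring A] [AddCommGroup X]
    [Module Aᵐᵒᵖ X] (f : X →ₗ[Aᵐᵒᵖ] A) {x : X} (hx : x ∈ Module.jacobson Aᵐᵒᵖ X) :
    f x ∈ Ring.jacobson A :=
  op_mem_jacobson.1 (Module.le_comap_jacobson ((unopEquiv A).symm.toLinearMap ∘ₗ f) hx)

theorem IsCyclicallyBlack.exists_resArrow {K A : Type u} [Field K] [Ring A] [Algebra K A]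
    {n : ℕ} {e : ZMod n → A} {i : ZMod n} (h : IsCyclicallyBlack K e i) :
    ∃ k, ResArrow K e k i := by
  obtain ⟨m, v, hm, -, hvm, harrow⟩ := h
  have hlast := (harrow (m - 1) (by lia)).1
  rw [Nat.sub_add_cancel hm, hvm] at hlast
  exact ⟨_, hlast⟩

variable {K A : Type u} [Field K] [Ring A] [Algebra K A] {n : ℕ} [NeZero n] {e : ZMod n → A}

theorem IsCNakayama.isSocleVertex_simpleAt (hA : IsCNakayama K e) (j : ZMod n) :
    IsSocleVertex e (simpleAt e j) j := by
  have hj : e j * e j = e j := hA.idem.idem j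
  let v : rightIdeal (e j) := ⟨e j, Submodule.mem_span_singleton_self _⟩
  refine ⟨Submodule.mkQ _ v, fun h => ?_, fun x hx => ?_⟩
  · have hv : op (e j) • v = v := Subtype.ext hj
    rw [← map_smul, hv] at h
    have hej : e j ∈ Ring.jacobson A := apply_mem_jacobson_of_mem_jacobson
      (rightIdeal (e j)).subtype ((Submodule.Quotient.mk_eq_zero _).1 h)
    obtain ⟨α, hα⟩ := hA.exists_isArrows
    exact hα.notMem_sq j (hα.idem_mul j ▸ Ideal.mul_mem_mul hej (hα.mem j))
  · exact (Submodule.Quotient.mk_eq_zero _).2 (op_smul_mem_jacobson hx v)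

theorem IsCNakayama.exists_smul_notMem_jacobson (hA : IsCNakayama K e) {T : Type u}
    [AddCommGroup T] [Module K T] [Module A T] [IsScalarTower K A T] {j : ZMod n}
    (hj : IsSocleVertex e (KDual K T) j) : ∃ t : T, e j • t ∉ Module.jacobson A T := by
  have := hA.isArtinianRing
  obtain ⟨ζ, hζ, hζJ⟩ := hj
  by_contra! h
  refine hζ (LinearMap.ext fun t => ?_)
  have ht := h t
  rw [jacobson_eq_jacobson_smul_top] at ht
  refine Submodule.smul_induction_on (p := fun t => (show T →ₗ[K] K from ζ) t = 0) ht
    (fun x hx t _ => LinearMap.congr_fun (hζJ x hx) t) fun s t hs ht => ?_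
  rw [map_add, hs, ht, add_zero]

theorem IsCNakayama.idem_mul_mem_jacobson (hA : IsCNakayama K e) {a : A} {j : ZMod n}
    (h : e j * a * e j ∈ Ring.jacobson A) : e j * a ∈ Ring.jacobson A := by
  rw [← mul_one (e j * a), ← hA.idem.complete, Finset.mul_sum]
  refine sum_mem fun k _ => ?_
  obtain rfl | hjk := eq_or_ne j k
  · exact h
  · exact hA.idem_mul_mul_mem_jacobson a hjk

theorem IsCNakayama.exists_op_smul_notMem_jacobson (hA : IsCNakayama K e) {P : Type u}
    [AddCommGroup P] [Module Aᵐᵒᵖ P] [Module.Finite Aᵐᵒᵖ P] [Module.Projective Aᵐᵒᵖ P] {j : ZMod n}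
    {g : P →ₗ[Aᵐᵒᵖ] A} (hg : e j • g ∉ Module.jacobson A (P →ₗ[Aᵐᵒᵖ] A)) :
    ∃ p : P, op (e j) • p ∉ Module.jacobson Aᵐᵒᵖ P := by
  by_contra! h
  refine hg (mem_jacobson_dual P fun p => hA.idem_mul_mem_jacobson ?_)
  have hgp := Ideal.mul_mem_left _ (e j) (apply_mem_jacobson_of_mem_jacobson g (h p))
  rwa [map_smul, op_smul_eq_mul, ← mul_assoc] at hgp

/-- The projective cover `P₁` of the syzygy `Ω M` has `e (j + 1) A` as a direct summand only if
`M` has an element not killed by `e j`: the radical of `P₀` is generated by arrows. -/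
theorem IsCNakayama.exists_op_smul_ne_zero (hA : IsCNakayama K e) {M : Type u} [AddCommGroup M]
    [Module Aᵐᵒᵖ M] (π : MinProjPres Aᵐᵒᵖ M) {j : ZMod n} {p : π.P₁}
    (hp : op (e (j + 1)) • p ∉ Module.jacobson Aᵐᵒᵖ π.P₁) : ∃ s : M, op (e j) • s ≠ 0 := by
  by_contra! h
  obtain ⟨α, hα⟩ := hA.exists_isArrows
  have hdp : π.d p ∈ Module.jacobson Aᵐᵒᵖ π.P₀ :=
    π.cover₀.ker_le_jacobson (π.exact.apply_apply_eq_zero p)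
  obtain ⟨q, hq⟩ := hα.exists_op_idem_smul_eq hA j hdp
  obtain ⟨p₁, hp₁⟩ := (π.exact (op (e j) • q)).1 (by rw [map_smul, h])
  have hker : π.d (op (e (j + 1)) • p - op (α j) • p₁) = 0 := by
    rw [map_sub, map_smul, map_smul, hp₁, hq, ← mul_smul, ← op_mul, hα.idem_mul, sub_self]
  exact hp ((Submodule.sub_mem_iff_left _ (op_smul_mem_jacobson (hα.mem j) p₁)).1
    (π.cover₁.ker_le_jacobson (Subtype.ext hker)))

theorem IsTau.exists_op_smul_ne_zero {M : Type u} [AddCommGroup M] [Module Aᵐᵒᵖ M] {j : ZMod n}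
    (h : IsTau K A (simpleAt e (j + 1)) M) (hA : IsCNakayama K e) :
    ∃ s : M, op (e j) • s ≠ 0 := by
  obtain ⟨π, ⟨Φ⟩⟩ := h
  have := π.finite₁
  have := π.cover₁.projective
  have hj : IsSocleVertex e (KDual K π.Tr) (j + 1) :=
    (hA.isSocleVertex_simpleAt (j + 1)).of_isCogenerated
      fun _ hx => ⟨Φ.toLinearMap, Φ.map_ne_zero_iff.2 hx⟩
  obtain ⟨t, ht⟩ := hA.exists_smul_notMem_jacobson hj
  obtain ⟨g, rfl⟩ := Submodule.mkQ_surjective _ t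
  have hg : e (j + 1) • g ∉ Module.jacobson A (π.P₁ →ₗ[Aᵐᵒᵖ] A) := fun hg =>
    ht (map_smul (Submodule.mkQ _) (e (j + 1)) g ▸ Module.le_comap_jacobson (Submodule.mkQ _) hg)
  obtain ⟨p, hp⟩ := hA.exists_op_smul_notMem_jacobson hg
  exact hA.exists_op_smul_ne_zero π hp

theorem ResArrow.isSocleVertex {k j : ZMod n} (h : ResArrow K e k (j + 1))
    (hA : IsCNakayama K e) : IsSocleVertex e A j := by
  obtain ⟨P, f, hf, hτ⟩ := h
  obtain ⟨s, hs⟩ := hτ.exists_op_smul_ne_zero hA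
  have := hf.projective
  have hj : IsSocleVertex e (socle Aᵐᵒᵖ P) j :=
    ⟨s, hs, fun x hx => jacobson_smul_socle_eq_zero (op_mem_jacobson.2 hx) s⟩
  exact hj.of_isCogenerated
    ((isCogenerated_of_projective P).of_injective (socle Aᵐᵒᵖ P).injective_subtype)

theorem ResArrow.projective_kDual {k i : ZMod n} (h : ResArrow K e k i) (hA : IsCNakayama K e) :
    Module.Projective Aᵐᵒᵖ (KDual K (leftIdeal (e (i - 1)))) := by
  rw [← sub_add_cancel i 1] at h
  exact hA.projective_kDual_of_isSocleVertex (h.isSocleVertex hA)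

end ResolutionQuiver

end Nak

theorem mainTheorem9_general {K A : Type u} [Field K] [Ring A] [Algebra K A] {n : ℕ} [NeZero n]
    (e : ZMod n → A) (hA : Nak.IsCNakayama K e) :
    (∀ k i : ZMod n, Nak.ResArrow K e k i →
      Module.Projective Aᵐᵒᵖ (Nak.KDual K (Nak.leftIdeal (e (i - 1))))) ∧
    (∀ (M : Type u) [AddCommGroup M] [Module Aᵐᵒᵖ M],
      Nak.InGorensteinCore A M → 2 ≤ Nak.domDim Aᵐᵒᵖ M) ∧
    Nak.IsGorensteinDominant A :=
  ⟨fun _ _ h => h.projective_kDual hA, fun _ _ _ hM => hM.two_le_domDim hA,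
    hA.isGorensteinDominant⟩

theorem mainTheorem9 {K A : Type u} [Field K] [Ring A] [Algebra K A] {n : ℕ} [NeZero n]
    (e : ZMod n → A) (hA : Nak.IsCNakayama K e) (hns : ¬ Module.Injective Aᵐᵒᵖ A) :
    (∀ i : ZMod n, Nak.IsCyclicallyBlack K e i →
      Module.Projective Aᵐᵒᵖ (Nak.KDual K (Nak.leftIdeal (e (i - 1))))) ∧
    (∀ (M : Type u) [AddCommGroup M] [Module Aᵐᵒᵖ M],
      Nak.InGorensteinCore A M → 2 ≤ Nak.domDim Aᵐᵒᵖ M) ∧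
    Nak.IsGorensteinDominant A :=
  (mainTheorem9_general e hA).imp_left fun h _ hi => let ⟨k, hk⟩ := hi.exists_resArrow; h k _ hk
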